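/- **Bounds on the growth-within-mode constants.** For an integer $k\ge 0$ let $\eta_k$ be the critical three-colour mean-field Potts distribution on $\{1,2,3\}^k$, $$\eta_k(\sigma)=\frac{\exp\big(k\,\tilde\beta_c\,(s_1(\sigma)^2+s_2(\sigma)^2+s_3(\sigma)^2)\big)}{Z_k},\qquad \tilde\beta_c=2\log 2,$$ where $s_i(\sigma)$ is the proportion of coordinates of $\sigma$ equal to $i$ and $Z_k$ is the normalising constant ($\eta_0$ is the point mass on the empty configuration). For $M\ge 1$ let $\Omega=\{1,2,3\}^M$ and let $\mu_0,\dots,\mu_M$ be the interpolation-to-independence sequence: under $\mu_k$ the first $k$ coordinates of $x\in\Omega$ have law $\eta_k$ and the remaining $M-k$ coordinates are i.i.d. uniform on $\{1,2,3\}$, independently of the first $k$. Fix a threshold $J\ge 1$ (for instance $J=10^7$, or $J=1$). For $0\le k\le J$ put $m(k)=1$ and $F_k^{(1)}=\Omega$; for $J<k\le M$ put $m(k)=4$ and $$F_k^{(i)}=\Big\{x\in\Omega:\ \frac1k\sum_{l=1}^k \mathbf 1[x_l=i]>\frac12\Big\}\ (i=1,2,3),\qquad F_k^{(4)}=\Omega\setminus\big(F_k^{(1)}\cup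 F_k^{(2)}\cup F_k^{(3)}\big).$$ For $0\le k\le M-1$ define the growth-within-mode constant $$B_{k,k+1}=\max_{1\le r\le m(k)}\frac{\mu_{k+1}(F_k^{(r)})}{\mu_k(F_k^{(r)})}.$$ Then $B_{0,1}=1$ for $M\ge 1$ and $B_{1,2}=1$ for $M\ge 2$, and there is an absolute constant $C>0$ (depending on none of $J$, $M$, $j$) such that for all $2\le j\le M-1$, $$B_{j,j+1}\le 1+C\,\frac{\log(j)^{3/2}}{j^{3/2}}.$$ -/

import Mathlib

open scoped BigOperators

noncomputable section

namespace MeanFieldPotts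

/-- A configuration of `k` spins with the three colours `0, 1, 2`. -/
abbrev Config (k : ℕ) : Type := Fin k → Fin 3

/-- The number of spins of colour `i` in the configuration `σ`. -/
def colourCount {k : ℕ} (σ : Config k) (i : Fin 3) : ℕ :=
  (Finset.univ.filter fun l : Fin k => σ l = i).card

/-- The ratio of spins of colour `i` in the configuration `σ`
(with the convention that it is `0` for the empty configuration). -/
def colourRatio {k : ℕ} (σ : Config k) (i : Fin 3) : ℝ :=
  (colourCount σ i : ℝ) / (k : ℝ)

/-- The unnormalised mean-field Potts weight `exp (k β (s₁² + s₂² + s₃²))`. -/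
def weight (β : ℝ) {k : ℕ} (σ : Config k) : ℝ :=
  Real.exp ((k : ℝ) * β * ∑ i : Fin 3, colourRatio σ i ^ 2)

/-- The normalising constant of the model with `k` spins. -/
def partitionFunction (β : ℝ) (k : ℕ) : ℝ :=
  ∑ σ : Config k, weight β σ

/-- The probability of `σ` under the three-colour mean-field Potts model with `k` spins. -/
def potts (β : ℝ) {k : ℕ} (σ : Config k) : ℝ :=
  weight β σ / partitionFunction β k

/-- The critical inverse temperature `2 log 2`. -/
def criticalBeta : ℝ := 2 * Real.log 2

/-- The first `k` spins of a configuration of `M` spins. -/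
def initialSpins {k M : ℕ} (h : k ≤ M) (x : Config M) : Config k :=
  fun l => x (Fin.castLE h l)

/-- The `k`-th distribution of the interpolation-to-independence sequence on `Config M`, as a
probability mass function: the first `k` spins follow the critical Potts model with `k` spins, and
each of the other `M - k` spins is uniform on the three colours, all independent. -/
def interpMass {k M : ℕ} (h : k ≤ M) (x : Config M) : ℝ :=
  potts criticalBeta (initialSpins h x) * (1 / 3 : ℝ) ^ (M - k)

open Classical in
/-- The probability of the event `S` under the `k`-th interpolating distribution. -/
def interpProb {k M : ℕ} (h : k ≤ M) (S : Set (Config M)) : ℝ :=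
  ∑ x ∈ Finset.univ.filter (fun x : Config M => x ∈ S), interpMass h x

/-- The number of modes at index `k`: one up to the threshold `J`, four beyond it. -/
def numModes (J k : ℕ) : ℕ := if k ≤ J then 1 else 4

/-- The configurations whose first `k` spins have colour `i` as a strict majority. -/
def majoritySet {k M : ℕ} (h : k ≤ M) (i : Fin 3) : Set (Config M) :=
  {x | 1 / 2 < colourRatio (initialSpins h x) i}

/-- The modes at index `k`, numbered from `0`. Up to the threshold `J` the only mode is the whole
space; beyond it, modes `0, 1, 2` are the strict-majority sets of the three colours, and mode `3`
is what remains. -/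
def mode (J : ℕ) {k M : ℕ} (h : k ≤ M) (r : Fin (numModes J k)) : Set (Config M) :=
  if k ≤ J then Set.univ
  else if hr : (r : ℕ) < 3 then majoritySet h ⟨r, hr⟩
  else (⋃ i : Fin 3, majoritySet h i)ᶜ

/-- The growth-within-mode constant `B_{k,k+1}` for configurations of `M` spins: the maximum over
the finitely many modes at index `k` of the ratio of their probabilities under the `(k+1)`-st and
the `k`-th interpolating distributions. -/
def growthConst (J : ℕ) {k M : ℕ} (h : k + 1 ≤ M) : ℝ :=
  ⨆ r : Fin (numModes J k),
    interpProb h (mode J (Nat.le_of_succ_le h) r) /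
      interpProb (Nat.le_of_succ_le h) (mode J (Nat.le_of_succ_le h) r)

end MeanFieldPotts

end

/-! ### A two-point exponential inequality -/

noncomputable section

namespace MeanFieldPotts

/-! For `k ≤ J` the only mode is the whole space and the constant is 1. Otherwise write `W r` for
the total Potts weight of basin `r`, and `V r` for the total weight after a spin is appended to the
configurations of that basin. It suffices that `V r = λ * W r * (1 + O(δ ^ 3))` with `δ` of order
`sqrt (log k / k)` and one and the same `λ = growthRate` for all four basins: summing over `r` then
controls `Z (k+1) / Z k` as well, and `λ` cancels in the ratio.

Criticality enters through the free energy. At `2 log 2` it has four equally high maximisers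
(`center`), with quadratic decay around them (`sum_exp_le`). Hence configurations at distance `δ`
from the centre of their basin are negligible (`sum_weight_far_le`), while every basin has weight at
least `λ ^ k / 2` (`growthRate_pow_le`).

Near a centre, `stepFactor σ / λ` is 1 plus terms of second order in the deviation of the profile
and of order `1/k`. Their mean must vanish up to `δ ^ 3`, which would normally require the limiting
Gaussian covariance. An exact symmetry replaces that computation: attach an extra spin distributed
as at the centre and exchange it with a spin of `σ` (`exchange_identity`). The resulting factor
averages to 1 up to negligible terms, and its second-order expansion is exactly twice that of the
step factor (`exists_second_order_bound`). -/

/-- The Kearns-Saul gap function for the two-point law with masses `2/3` and `1/3`. -/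
def ksGap (w : ℝ) : ℝ :=
  w / 3 + 12 / 25 * w ^ 2 - Real.log (2 / 3 * Real.exp w + 1 / 3 * Real.exp (-w))

/-- The derivative of `ksGap`. -/
def ksGap' (w : ℝ) : ℝ :=
  1 / 3 + 24 / 25 * w - (1 - 2 / (2 * Real.exp (2 * w) + 1))

lemma hasDerivAt_ksGap (w : ℝ) : HasDerivAt ksGap (ksGap' w) w := by
  have hpos : 0 < 2 / 3 * Real.exp w + 1 / 3 * Real.exp (-w) := by positivity
  have h1 : HasDerivAt (fun w : ℝ => 2 / 3 * Real.exp w + 1 / 3 * Real.exp (-w))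
      (2 / 3 * Real.exp w + 1 / 3 * (Real.exp (-w) * -1)) w :=
    ((Real.hasDerivAt_exp w).const_mul _).add
      (((hasDerivAt_neg w).exp).const_mul _)
  have h2 := (((hasDerivAt_id w).div_const 3).add
    (((hasDerivAt_id w).pow 2).const_mul (12 / 25))).sub (h1.log hpos.ne')
  refine h2.congr_deriv ?_
  have e1 : Real.exp (2 * w) = Real.exp w * Real.exp w := by rw [← Real.exp_add]; ring_nf
  have e2 : Real.exp (-w) = (Real.exp w)⁻¹ := Real.exp_neg w
  have h3 : 0 < Real.exp w := Real.exp_pos w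
  simp only [ksGap', e1, e2, id]
  field_simp
  ring

lemma hasDerivAt_ksGap' (w : ℝ) :
    HasDerivAt ksGap' (24 / 25 - 8 * Real.exp (2 * w) / (2 * Real.exp (2 * w) + 1) ^ 2) w := by
  have hpos : 0 < 2 * Real.exp (2 * w) + 1 := by positivity
  have h0 : HasDerivAt (fun w : ℝ => 2 * w) 2 w := by
    simpa using (hasDerivAt_id w).const_mul (2 : ℝ)
  have h1 : HasDerivAt (fun w : ℝ => 2 * Real.exp (2 * w) + 1)
      (2 * (Real.exp (2 * w) * 2)) w := (h0.exp.const_mul 2).add_const 1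
  have h2 := (((hasDerivAt_id w).const_mul (24 / 25)).const_add (1 / 3)).sub
    (((h1.inv hpos.ne').const_mul 2).const_sub 1)
  have h3 : ksGap' = fun w => 1 / 3 + 24 / 25 * id w - (1 - 2 * (2 * Real.exp (2 * w) + 1)⁻¹) := by
    funext w; simp [ksGap', div_eq_mul_inv]
  rw [h3]
  refine h2.congr_deriv ?_
  field_simp
  ring

lemma deriv_ksGap : deriv ksGap = ksGap' := funext fun w => (hasDerivAt_ksGap w).deriv

lemma deriv_deriv_ksGap (w : ℝ) : deriv^[2] ksGap w =
    24 / 25 - 8 * Real.exp (2 * w) / (2 * Real.exp (2 * w) + 1) ^ 2 := by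
  simp [deriv_ksGap, (hasDerivAt_ksGap' w).deriv]

lemma continuous_ksGap : Continuous ksGap :=
  continuous_iff_continuousAt.2 fun w => (hasDerivAt_ksGap w).continuousAt

/-- With `E = exp (2 * w)`, the second derivative has the sign of `12 * E ^ 2 - 13 * E + 3`, whose
roots are `1/3` and `3/4`; the coefficient `12/25` makes them rational. -/
lemma convexOn_ksGap : ConvexOn ℝ (Set.Ici (Real.log (3 / 4) / 2)) ksGap := by
  refine convexOn_of_deriv2_nonneg (convex_Ici _) continuous_ksGap.continuousOn
    (fun w _ => (hasDerivAt_ksGap w).differentiableAt.differentiableWithinAt)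
    (fun w _ => by
      rw [deriv_ksGap]; exact (hasDerivAt_ksGap' w).differentiableAt.differentiableWithinAt) ?_
  intro w hw
  rw [interior_Ici, Set.mem_Ioi] at hw
  rw [deriv_deriv_ksGap]
  have h1 : 3 / 4 < Real.exp (2 * w) := by
    rw [← Real.log_lt_iff_lt_exp (by norm_num)]; linarith
  rw [sub_nonneg, div_le_iff₀ (by positivity)]
  nlinarith

lemma concaveOn_ksGap :
    ConcaveOn ℝ (Set.Icc (-(Real.log 2 / 2)) (Real.log (3 / 4) / 2)) ksGap := by
  refine concaveOn_of_deriv2_nonpos (convex_Icc _ _) continuous_ksGap.continuousOn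
    (fun w _ => (hasDerivAt_ksGap w).differentiableAt.differentiableWithinAt)
    (fun w _ => by
      rw [deriv_ksGap]; exact (hasDerivAt_ksGap' w).differentiableAt.differentiableWithinAt) ?_
  intro w hw
  rw [interior_Icc, Set.mem_Ioo] at hw
  rw [deriv_deriv_ksGap]
  have h1 : Real.exp (2 * w) < 3 / 4 := by
    rw [← Real.lt_log_iff_exp_lt (by norm_num)]; linarith
  have h2 : 1 / 2 < Real.exp (2 * w) := by
    rw [← Real.log_lt_iff_lt_exp (by norm_num), one_div, Real.log_inv]; linarith
  rw [sub_nonpos, le_div_iff₀ (by positivity)]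
  nlinarith

lemma ksGap_nonneg_of_ge {w : ℝ} (hw : Real.log (3 / 4) / 2 ≤ w) : 0 ≤ ksGap w := by
  have h0 : ksGap 0 = 0 := by simp [ksGap]; norm_num
  have h0' : ksGap' 0 = 0 := by simp [ksGap']; norm_num
  have hd : HasDerivAt ksGap 0 0 := (hasDerivAt_ksGap 0).congr_deriv h0'
  have hlog : Real.log (3 / 4) / 2 < 0 := by
    have := Real.log_neg (x := 3 / 4) (by norm_num) (by norm_num)
    linarith
  rcases lt_trichotomy w 0 with h | h | h
  · have := convexOn_ksGap.slope_le_of_hasDerivAt (Set.mem_Ici.2 hw) (Set.mem_Ici.2 hlog.le) h hd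
    rw [slope_def_field, h0, div_nonpos_iff] at this
    rcases this with h' | h' <;> linarith [h'.1, h'.2]
  · rw [h, h0]
  · have := convexOn_ksGap.le_slope_of_hasDerivAt (Set.mem_Ici.2 hlog.le) (Set.mem_Ici.2 hw) h hd
    rw [slope_def_field, h0, div_nonneg_iff] at this
    rcases this with h' | h' <;> linarith [h'.1, h'.2]

/-- On the convex range the graph lies above its tangent at 0, which is zero; on the concave range
the minimum is at an endpoint, so only `w = -(log 2) / 2` needs numerics. -/
lemma ksGap_nonneg {w : ℝ} (hw : -(Real.log 2 / 2) ≤ w) : 0 ≤ ksGap w := by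
  rcases le_total (Real.log (3 / 4) / 2) w with h | h
  · exact ksGap_nonneg_of_ge h
  have hle := hw.trans h
  refine le_trans (le_min ?_ (ksGap_nonneg_of_ge le_rfl))
    (concaveOn_ksGap.min_le_of_mem_Icc ⟨le_rfl, hle⟩ ⟨hle, le_rfl⟩ ⟨hw, h⟩)
  have hsq : Real.exp (Real.log 2 / 2) ^ 2 = 2 := by
    rw [← Real.exp_nat_mul]; push_cast; rw [mul_div_cancel₀ _ (by norm_num), Real.exp_log two_pos]
  have hpos := Real.exp_pos (Real.log 2 / 2)
  have hval : 2 / 3 * Real.exp (-(Real.log 2 / 2)) + 1 / 3 * Real.exp (Real.log 2 / 2)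
      = 2 / 3 * Real.exp (Real.log 2 / 2) := by
    rw [Real.exp_neg]; field_simp; nlinarith
  have hlog : Real.log (2 / 3 * Real.exp (Real.log 2 / 2)) =
      3 / 2 * Real.log 2 - Real.log 3 := by
    rw [Real.log_mul (by norm_num) hpos.ne', Real.log_exp, Real.log_div (by norm_num) (by norm_num)]
    ring
  -- `3 ^ 12` barely exceeds `2 ^ 19`, which yields a sharp lower bound on `log 3`; the gap at this
  -- endpoint is only about `0.001`.
  have h3 : 12 * Real.log 3 = 19 * Real.log 2 + Real.log (3 ^ 12 / 2 ^ 19) := by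
    rw [Real.log_div (by norm_num) (by norm_num), Real.log_pow, Real.log_pow]; push_cast; ring
  have h4 := Real.one_sub_inv_le_log_of_pos (x := 3 ^ 12 / 2 ^ 19) (by norm_num)
  have h5 := Real.log_two_gt_d9
  have h6 := Real.log_two_lt_d9
  rw [ksGap, neg_neg, hval, hlog]
  norm_num at h4
  nlinarith

/-- A Kearns-Saul type bound for the two-point law with masses `2/3` and `1/3`. -/
lemma kearns_saul {w : ℝ} (hw : -(Real.log 2 / 2) ≤ w) :
    2 / 3 * Real.exp w + 1 / 3 * Real.exp (-w) ≤ Real.exp (w / 3 + 12 / 25 * w ^ 2) := by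
  have h := ksGap_nonneg hw
  rw [ksGap, sub_nonneg] at h
  exact (Real.log_le_iff_le_exp (by positivity)).1 h

/-- Recentring at `t = 1/6` turns the two exponentials into a law with masses `2/3` and `1/3`, and
`t ≥ 0` becomes the range of `kearns_saul`. -/
lemma exp_add_exp_neg_le {t : ℝ} (ht : 0 ≤ t) :
    Real.exp (3 * Real.log 2 * t) + Real.exp (-(3 * Real.log 2 * t)) ≤
      3 / 2 * Real.exp (3 * Real.log 2 * t ^ 2 + 5 / 12 * Real.log 2 -
        1 / 2000 * (t - 1 / 6) ^ 2) := by
  have h5 := Real.log_two_gt_d9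
  have h6 := Real.log_two_lt_d9
  have h := kearns_saul (w := 3 * Real.log 2 * (t - 1 / 6)) (by nlinarith)
  set L := Real.log 2 with hL
  have hsq : Real.exp (L / 2) * Real.exp (L / 2) = 2 := by
    rw [← Real.exp_add, add_halves, hL, Real.exp_log two_pos]
  have hpos := Real.exp_pos (L / 2)
  have e1 : Real.exp (3 * L * t) = Real.exp (L / 2) * Real.exp (3 * L * (t - 1 / 6)) := by
    rw [← Real.exp_add]; ring_nf
  have e2 : Real.exp (-(3 * L * t)) =
      Real.exp (L / 2) * (1 / 2) * Real.exp (-(3 * L * (t - 1 / 6))) := by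
    have : Real.exp (L / 2) * (1 / 2) = Real.exp (-(L / 2)) := by
      rw [Real.exp_neg]; field_simp; linarith
    rw [this, ← Real.exp_add]; ring_nf
  calc _ = 3 / 2 * (Real.exp (L / 2) * (2 / 3 * Real.exp (3 * L * (t - 1 / 6)) +
        1 / 3 * Real.exp (-(3 * L * (t - 1 / 6))))) := by rw [e1, e2]; ring
    _ ≤ 3 / 2 * (Real.exp (L / 2) * Real.exp (3 * L * (t - 1 / 6) / 3 +
        12 / 25 * (3 * L * (t - 1 / 6)) ^ 2)) := by gcongr
    _ ≤ _ := by
      rw [← Real.exp_add]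
      gcongr
      -- Since `12/25 < 1 / (3 * log 2)`, the quadratic coefficient leaves a positive surplus, of
      -- which `1/2000` is kept.
      have : 0 ≤ (L * (3 - 108 / 25 * L) - 1 / 2000) * (t - 1 / 6) ^ 2 := by
        refine mul_nonneg ?_ (sq_nonneg _)
        nlinarith
      nlinarith

/-- To first order in `y` the left side grows at relative rate at most `(2/3) * 8 * log 2 ^ 2`,
because `v` is at most two thirds of the mass; this is below `4 * log 2`. The bound on `y` absorbs
the quadratic remainders. -/
lemma transverse_le {u v y : ℝ} (hv : 0 ≤ v) (huv : v ≤ 2 * u) (hy : 0 ≤ y) (hy' : y ≤ 1 / 16) :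
    u + v * Real.exp (8 * Real.log 2 ^ 2 * y) ≤
      (u + v) * Real.exp ((4 * Real.log 2 - 1 / 2000) * y) := by
  have h5 := Real.log_two_gt_d9
  have h6 := Real.log_two_lt_d9
  set L := Real.log 2
  set A := 4 * L - 1 / 2000 with hA
  set B := 8 * L ^ 2 - A with hB
  have hA1 : A ≤ 2.7726 := by norm_num at h5 h6 ⊢; linarith
  have hA2 : 2.772 ≤ A := by norm_num at h5 h6 ⊢; linarith
  have hB1 : B ≤ 1.0717 := by norm_num at h5 h6 ⊢; nlinarith
  have hB2 : 0 ≤ B := by norm_num at h5 h6 ⊢; nlinarith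
  have hAy : 0 ≤ A * y := by positivity
  have hBy : 0 ≤ B * y := by positivity
  have b1 : Real.exp (-(A * y)) ≤ 1 - A * y + (A * y) ^ 2 := by
    have := Real.norm_exp_sub_one_sub_id_le (x := -(A * y)) (by
      rw [norm_neg, Real.norm_of_nonneg hAy]; nlinarith)
    rw [norm_neg, Real.norm_of_nonneg hAy, Real.norm_eq_abs] at this
    linarith [le_abs_self (Real.exp (-(A * y)) - 1 - -(A * y))]
  have b2 : Real.exp (B * y) ≤ 1 + B * y + (B * y) ^ 2 := by
    have := Real.norm_exp_sub_one_sub_id_le (x := B * y) (by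
      rw [Real.norm_of_nonneg hBy]; nlinarith)
    rw [Real.norm_of_nonneg hBy, Real.norm_eq_abs] at this
    linarith [le_abs_self (Real.exp (B * y) - 1 - B * y)]
  have hu : 0 ≤ u := by linarith
  have key : 2 * (B + B ^ 2 * y) ≤ A - A ^ 2 * y := by
    have : B ^ 2 ≤ 1.0717 ^ 2 := by gcongr
    have : A ^ 2 ≤ 2.7726 ^ 2 := by gcongr
    nlinarith
  have key2 : 0 ≤ B + B ^ 2 * y := by positivity
  have e1 : Real.exp (8 * L ^ 2 * y) = Real.exp (A * y) * Real.exp (B * y) := by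
    rw [← Real.exp_add, hB]; ring_nf
  have e2 : Real.exp (A * y) * Real.exp (-(A * y)) = 1 := by rw [← Real.exp_add]; simp
  calc u + v * Real.exp (8 * L ^ 2 * y)
      = Real.exp (A * y) * (u * Real.exp (-(A * y)) + v * Real.exp (B * y)) := by
        rw [e1]; linear_combination -u * e2
    _ ≤ Real.exp (A * y) * (u * (1 - A * y + (A * y) ^ 2) + v * (1 + B * y + (B * y) ^ 2)) := by
        gcongr
    _ ≤ Real.exp (A * y) * (u + v) := by
        refine mul_le_mul_of_nonneg_left ?_ (Real.exp_pos _).le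
        have : v * (B + B ^ 2 * y) ≤ u * (A - A ^ 2 * y) := by
          calc _ ≤ 2 * u * (B + B ^ 2 * y) := by gcongr
            _ = u * (2 * (B + B ^ 2 * y)) := by ring
            _ ≤ _ := by gcongr
        nlinarith [mul_le_mul_of_nonneg_right this hy]
    _ = _ := mul_comm _ _

/-! ### The critical free energy and its four maximisers -/

/-- The exponential growth rate of the critical partition function. -/
def growthRate : ℝ := 3 * Real.exp (2 / 3 * Real.log 2)

lemma growthRate_pos : 0 < growthRate := by unfold growthRate; positivity

/-- The difference `q - r` is split off by `cosh x ≤ exp (x ^ 2 / 2)`. What remains is, up to an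
explicit factor, even in `p - 1/2`, so the ordered value `p = 2/3` and the disordered value `p =
1/3` are tied: this is phase coexistence. -/
lemma sum_exp_le_aux {p q r : ℝ} (hsum : p + q + r = 1) (hp : 1 / 3 ≤ p)
    (hqr : (q - r) ^ 2 ≤ 1 / 4) :
    Real.exp (4 * Real.log 2 * p) + Real.exp (4 * Real.log 2 * q) + Real.exp (4 * Real.log 2 * r) ≤
      growthRate * Real.exp (2 * Real.log 2 * (p ^ 2 + q ^ 2 + r ^ 2)) *
        Real.exp (-(1 / 2000 * ((|p - 1 / 2| - 1 / 6) ^ 2 + ((q - r) / 2) ^ 2))) := by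
  set L := Real.log 2 with hL
  have hLpos : 0 < L := Real.log_pos one_lt_two
  have hL2 : Real.exp L = 2 := Real.exp_log two_pos
  set d := (q - r) / 2 with hd
  have hq : q = (1 - p) / 2 + d := by rw [hd]; linarith
  have hr : r = (1 - p) / 2 - d := by rw [hd]; linarith
  set u := Real.exp (4 * L * p) with hu
  set v := Real.exp (L + 2 * L * (1 - p)) with hv
  have hv2 : v = 2 * Real.exp (2 * L * (1 - p)) := by rw [hv, Real.exp_add, hL2]
  have huv : v ≤ 2 * u := by
    rw [hv2, hu]
    have : 2 * L * (1 - p) ≤ 4 * L * p := by nlinarith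
    gcongr
  have hcosh : Real.exp (4 * L * q) + Real.exp (4 * L * r) = v * Real.cosh (4 * L * d) := by
    rw [hv2, Real.cosh_eq, hq, hr]
    have e1 : Real.exp (4 * L * ((1 - p) / 2 + d)) =
      Real.exp (2 * L * (1 - p)) * Real.exp (4 * L * d) := by rw [← Real.exp_add]; ring_nf
    have e2 : Real.exp (4 * L * ((1 - p) / 2 - d)) =
      Real.exp (2 * L * (1 - p)) * Real.exp (-(4 * L * d)) := by rw [← Real.exp_add]; ring_nf
    rw [e1, e2]; ring
  have h1 := Real.cosh_le_exp_half_sq (4 * L * d)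
  have h2 := transverse_le (y := d ^ 2) (Real.exp_pos _).le huv (sq_nonneg d)
    (by rw [hd, div_pow]; linarith)
  have h3 := exp_add_exp_neg_le (abs_nonneg (p - 1 / 2))
  have h4 : u + v = Real.exp (2 * L + L * (p - 1 / 2)) *
      (Real.exp (3 * L * |p - 1 / 2|) + Real.exp (-(3 * L * |p - 1 / 2|))) := by
    have e1 : u = Real.exp (2 * L + L * (p - 1 / 2)) * Real.exp (3 * L * (p - 1 / 2)) := by
      rw [hu, ← Real.exp_add]; ring_nf
    have e2 : v = Real.exp (2 * L + L * (p - 1 / 2)) * Real.exp (-(3 * L * (p - 1 / 2))) := by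
      rw [hv, ← Real.exp_add]; ring_nf
    rcases abs_choice (p - 1 / 2) with h | h <;> rw [h, e1, e2]
    · ring
    · rw [mul_neg, neg_neg]; ring
  have h5 : growthRate = 3 / 2 * Real.exp (5 / 3 * L) := by
    have : Real.exp (5 / 3 * L) = Real.exp (2 / 3 * L) * Real.exp L := by
      rw [← Real.exp_add]; ring_nf
    rw [growthRate, this, hL2]; ring
  calc u + Real.exp (4 * L * q) + Real.exp (4 * L * r) = u + v * Real.cosh (4 * L * d) := by
        rw [← hcosh]; ring
    _ ≤ u + v * Real.exp (8 * L ^ 2 * d ^ 2) := by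
        gcongr; refine h1.trans (le_of_eq ?_); ring_nf
    _ ≤ (u + v) * Real.exp ((4 * L - 1 / 2000) * d ^ 2) := h2
    _ ≤ Real.exp (2 * L + L * (p - 1 / 2)) * (3 / 2 * Real.exp (3 * L * |p - 1 / 2| ^ 2 +
          5 / 12 * L - 1 / 2000 * (|p - 1 / 2| - 1 / 6) ^ 2)) *
          Real.exp ((4 * L - 1 / 2000) * d ^ 2) := by rw [h4]; gcongr
    _ = _ := by
        rw [h5, sq_abs, mul_left_comm, mul_assoc, mul_assoc, mul_assoc, mul_assoc, ← Real.exp_add,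
          ← Real.exp_add, ← Real.exp_add, mul_assoc, ← Real.exp_add, hq, hr]
        congr 2
        ring

/-- The four maximisers of the critical mean-field free energy: the ordered phases are
numbered `0, 1, 2` by their dominant colour, and phase `3` is disordered. -/
def center (r : Fin 4) (c : Fin 3) : ℝ :=
  if (r : ℕ) = 3 then 1 / 3 else if (c : ℕ) = (r : ℕ) then 2 / 3 else 1 / 6

/-- The profile `s` belongs to the basin numbered `r`. -/
def InBasin (r : Fin 4) (s : Fin 3 → ℝ) : Prop :=
  if hr : (r : ℕ) < 3 then 1 / 2 < s ⟨r, hr⟩ else ∀ i, s i ≤ 1 / 2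

lemma sum_exp_le_ordered {p q r : ℝ} (hsum : p + q + r = 1) (hp : 1 / 2 < p) (hq : 0 ≤ q)
    (hr : 0 ≤ r) {z : ℝ} (hz : z ^ 2 ≤ 2 * ((p - 2 / 3) ^ 2 + ((q - r) / 2) ^ 2)) :
    Real.exp (4 * Real.log 2 * p) + Real.exp (4 * Real.log 2 * q) + Real.exp (4 * Real.log 2 * r) ≤
      growthRate * Real.exp (2 * Real.log 2 * (p ^ 2 + q ^ 2 + r ^ 2)) *
        Real.exp (-(1 / 4000 * z ^ 2)) := by
  refine (sum_exp_le_aux hsum (by linarith) (by nlinarith)).trans ?_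
  have := growthRate_pos
  refine mul_le_mul_of_nonneg_left (Real.exp_le_exp.2 ?_) (by positivity)
  rw [abs_of_pos (by linarith)]
  linarith

lemma sum_exp_le_disordered {p q r : ℝ} (hsum : p + q + r = 1) (hp : p ≤ 1 / 2) (hq : q ≤ p)
    (hr : r ≤ p) {z : ℝ} (hz : z ^ 2 ≤ 2 * ((p - 1 / 3) ^ 2 + ((q - r) / 2) ^ 2)) :
    Real.exp (4 * Real.log 2 * p) + Real.exp (4 * Real.log 2 * q) + Real.exp (4 * Real.log 2 * r) ≤
      growthRate * Real.exp (2 * Real.log 2 * (p ^ 2 + q ^ 2 + r ^ 2)) *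
        Real.exp (-(1 / 4000 * z ^ 2)) := by
  refine (sum_exp_le_aux hsum (by linarith) ?_).trans ?_
  · have : |q - r| ≤ 1 / 2 := abs_le.2 ⟨by linarith, by linarith⟩
    rw [← sq_abs]
    nlinarith [abs_nonneg (q - r)]
  have := growthRate_pos
  refine mul_le_mul_of_nonneg_left (Real.exp_le_exp.2 ?_) (by positivity)
  rw [abs_of_nonpos (by linarith)]
  have : (-(p - 1 / 2) - 1 / 6) ^ 2 = (p - 1 / 3) ^ 2 := by ring
  linarith

lemma sum_exp_le {s : Fin 3 → ℝ} (h0 : ∀ i, 0 ≤ s i) (h1 : ∑ i, s i = 1) {r : Fin 4}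
    (hr : InBasin r s) (c : Fin 3) :
    ∑ i, Real.exp (4 * Real.log 2 * s i) ≤
      growthRate * Real.exp (2 * Real.log 2 * ∑ i, s i ^ 2) *
        Real.exp (-(1 / 4000 * (s c - center r c) ^ 2)) := by
  rw [Fin.sum_univ_three] at h1 ⊢
  rw [Fin.sum_univ_three]
  have n0 := h0 0
  have n1 := h0 1
  have n2 := h0 2
  set x := s 0 with hx
  set y := s 1 with hy
  set w := s 2 with hw
  have a1 : Real.exp (4 * Real.log 2 * x) + Real.exp (4 * Real.log 2 * y) +
      Real.exp (4 * Real.log 2 * w) = Real.exp (4 * Real.log 2 * y) +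
      Real.exp (4 * Real.log 2 * w) + Real.exp (4 * Real.log 2 * x) := by ring
  have a2 : Real.exp (4 * Real.log 2 * x) + Real.exp (4 * Real.log 2 * y) +
      Real.exp (4 * Real.log 2 * w) = Real.exp (4 * Real.log 2 * w) +
      Real.exp (4 * Real.log 2 * x) + Real.exp (4 * Real.log 2 * y) := by ring
  have b1 : x ^ 2 + y ^ 2 + w ^ 2 = y ^ 2 + w ^ 2 + x ^ 2 := by ring
  have b2 : x ^ 2 + y ^ 2 + w ^ 2 = w ^ 2 + x ^ 2 + y ^ 2 := by ring
  -- Any single coordinate's squared deviation is at most twice the longitudinal plus transverse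
  -- part, hence the passage from `1/2000` to `1/4000`.
  have key : ∀ p q r μ : ℝ, p + q + r = 1 →
      (p - μ) ^ 2 ≤ 2 * ((p - μ) ^ 2 + ((q - r) / 2) ^ 2) ∧
      (q - (1 - μ) / 2) ^ 2 ≤ 2 * ((p - μ) ^ 2 + ((q - r) / 2) ^ 2) ∧
      (r - (1 - μ) / 2) ^ 2 ≤ 2 * ((p - μ) ^ 2 + ((q - r) / 2) ^ 2) := by
    intro p q r μ h
    obtain rfl : p = 1 - q - r := by linarith
    refine ⟨by nlinarith [sq_nonneg (1 - q - r - μ), sq_nonneg (q - r)], ?_, ?_⟩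
    · nlinarith [sq_nonneg (3 * (1 - q - r - μ) + (q - r)), sq_nonneg (1 - q - r - μ + (q - r)),
        sq_nonneg (1 - q - r - μ), sq_nonneg (q - r)]
    · nlinarith [sq_nonneg (3 * (1 - q - r - μ) - (q - r)), sq_nonneg (1 - q - r - μ - (q - r)),
        sq_nonneg (1 - q - r - μ), sq_nonneg (q - r)]
  by_cases hr3 : r = 3
  · subst hr3
    simp only [InBasin, show ¬ ((3 : Fin 4) : ℕ) < 3 by decide, dite_false] at hr
    have k0 : x ≤ 1 / 2 := hr 0
    have k1 : y ≤ 1 / 2 := hr 1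
    have k2 : w ≤ 1 / 2 := hr 2
    have hc : center 3 c = 1 / 3 := by simp [center]
    rw [hc]
    have hthird : (1 - 1 / 3 : ℝ) / 2 = 1 / 3 := by norm_num
    -- In the disordered basin a largest proportion plays the role of `p`.
    rcases le_total y x with h | h <;> rcases le_total w x with h' | h' <;>
      rcases le_total w y with h'' | h''
    all_goals first
      | (refine sum_exp_le_disordered (p := x) h1 k0 (by linarith) (by linarith) ?_
         have := key x y w (1 / 3) h1
         rw [hthird] at this
         fin_cases c
         exacts [this.1, this.2.1, this.2.2])
      | (rw [a1, b1]
         refine sum_exp_le_disordered (p := y) (by linarith) k1 (by linarith) (by linarith) ?_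
         have := key y w x (1 / 3) (by linarith)
         rw [hthird] at this
         fin_cases c
         exacts [this.2.2, this.1, this.2.1])
      | (rw [a2, b2]
         refine sum_exp_le_disordered (p := w) (by linarith) k2 (by linarith) (by linarith) ?_
         have := key w x y (1 / 3) (by linarith)
         rw [hthird] at this
         fin_cases c
         exacts [this.2.1, this.2.2, this.1])
  have hsixth : (1 - 2 / 3 : ℝ) / 2 = 1 / 6 := by norm_num
  obtain rfl | rfl | rfl : r = 0 ∨ r = 1 ∨ r = 2 := by fin_cases r <;> simp_all
  · replace hr : 1 / 2 < x := by simpa [InBasin] using hr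
    refine sum_exp_le_ordered (p := x) h1 hr n1 n2 ?_
    have := key x y w (2 / 3) h1
    rw [hsixth] at this
    fin_cases c <;> simp only [center]
    exacts [this.1, this.2.1, this.2.2]
  · replace hr : 1 / 2 < y := by simpa [InBasin] using hr
    rw [a1, b1]
    refine sum_exp_le_ordered (p := y) (by linarith) hr n2 n0 ?_
    have := key y w x (2 / 3) (by linarith)
    rw [hsixth] at this
    fin_cases c <;> simp only [center]
    exacts [this.2.2, this.1, this.2.1]
  · replace hr : 1 / 2 < w := by simpa [InBasin] using hr
    rw [a2, b2]
    refine sum_exp_le_ordered (p := w) (by linarith) hr n0 n1 ?_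
    have := key w x y (2 / 3) (by linarith)
    rw [hsixth] at this
    fin_cases c <;> simp only [center]
    exacts [this.2.1, this.2.2, this.1]

lemma center_pos (r : Fin 4) (c : Fin 3) : 0 < center r c := by
  unfold center; split_ifs <;> norm_num

lemma sum_center (r : Fin 4) : ∑ c, center r c = 1 := by
  fin_cases r <;> simp [center, Fin.sum_univ_three] <;> norm_num

/-- The mean-field fixed-point equation. That the prefactor `growthRate` does not depend on the
phase expresses criticality; summed over colours, this is the equality case of `sum_exp_le`. -/
lemma exp_center (r : Fin 4) (c : Fin 3) : Real.exp (4 * Real.log 2 * center r c) =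
    growthRate * Real.exp (2 * Real.log 2 * ∑ i, center r i ^ 2) * center r c := by
  have h2 : Real.exp (2 * Real.log 2) = 4 := by
    rw [two_mul, Real.exp_add, Real.exp_log two_pos]; norm_num
  have h2' : Real.exp (Real.log 2) = 2 := Real.exp_log two_pos
  rw [growthRate, mul_assoc 3, ← Real.exp_add]
  by_cases hr : (r : ℕ) = 3
  · simp only [center, hr, if_true, Fin.sum_univ_three]
    rw [mul_right_comm]
    norm_num
    ring_nf
  · have hs : ∑ i, center r i ^ 2 = 1 / 2 := by
      fin_cases r <;> simp [center, Fin.sum_univ_three] at hr ⊢ <;> norm_num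
    rw [hs]
    have e : Real.exp (2 / 3 * Real.log 2 + 2 * Real.log 2 * (1 / 2)) =
        2 * Real.exp (2 / 3 * Real.log 2) := by
      rw [Real.exp_add, show 2 * Real.log 2 * (1 / 2) = Real.log 2 by ring, h2', mul_comm]
    rw [e, center, if_neg hr]
    split_ifs
    · rw [show 4 * Real.log 2 * (2 / 3) = 2 * Real.log 2 + 2 / 3 * Real.log 2 by ring,
        Real.exp_add, h2]
      ring
    · rw [show 4 * Real.log 2 * (1 / 6) = 2 / 3 * Real.log 2 by ring]
      ring

/-! ### Second-order jets with cubic remainder -/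

/-- On the set `S`, the function `f` agrees with `f₀ + f₁ + f₂` up to third order in `δ`, where
`f₁` and `f₂` are of first and second order. -/
structure HasJet {α : Type*} (S : Set α) (δ : α → ℝ) (f : α → ℝ) (f₀ : ℝ) (f₁ f₂ : α → ℝ) :
    Prop where
  first : f₁ =O[Filter.principal S] δ
  second : f₂ =O[Filter.principal S] fun a => δ a ^ 2
  remainder : (fun a => f a - (f₀ + f₁ a + f₂ a)) =O[Filter.principal S] fun a => δ a ^ 3

namespace HasJet

variable {α : Type*} {S : Set α} {δ : α → ℝ}

lemma pow_isBigO_pow (hδ : ∀ a ∈ S, 0 ≤ δ a ∧ δ a ≤ 1) {i j : ℕ} (h : j ≤ i) :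
    (fun a => δ a ^ i) =O[Filter.principal S] fun a => δ a ^ j := by
  refine Asymptotics.IsBigO.of_bound 1 (Filter.eventually_principal.2 fun a ha => ?_)
  have := hδ a ha
  rw [one_mul, Real.norm_of_nonneg (pow_nonneg this.1 _), Real.norm_of_nonneg (pow_nonneg this.1 _)]
  exact pow_le_pow_of_le_one this.1 this.2 h

lemma mul_isBigO (hδ : ∀ a ∈ S, 0 ≤ δ a ∧ δ a ≤ 1) {i j n : ℕ} (h : n ≤ i + j) {f g : α → ℝ}
    (hf : f =O[Filter.principal S] fun a => δ a ^ i)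
    (hg : g =O[Filter.principal S] fun a => δ a ^ j) :
    (fun a => f a * g a) =O[Filter.principal S] fun a => δ a ^ n := by
  refine (hf.mul hg).trans ?_
  simp_rw [← pow_add]
  exact pow_isBigO_pow hδ h

lemma const (c : ℝ) : HasJet S δ (fun _ => c) c 0 0 :=
  ⟨Asymptotics.isBigO_zero _ _, Asymptotics.isBigO_zero _ _, by
    simpa using Asymptotics.isBigO_zero _ _⟩

lemma of_first {f : α → ℝ} (h : f =O[Filter.principal S] δ) : HasJet S δ f 0 f 0 :=
  ⟨h, Asymptotics.isBigO_zero _ _, by simpa using Asymptotics.isBigO_zero _ _⟩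

lemma of_second {f : α → ℝ} (h : f =O[Filter.principal S] fun a => δ a ^ 2) : HasJet S δ f 0 0 f :=
  ⟨Asymptotics.isBigO_zero _ _, h, by simpa using Asymptotics.isBigO_zero _ _⟩

lemma add {f g : α → ℝ} {f₀ g₀ : ℝ} {f₁ f₂ g₁ g₂ : α → ℝ} (hf : HasJet S δ f f₀ f₁ f₂)
    (hg : HasJet S δ g g₀ g₁ g₂) :
    HasJet S δ (fun a => f a + g a) (f₀ + g₀) (f₁ + g₁) (f₂ + g₂) :=
  ⟨hf.first.add hg.first, hf.second.add hg.second,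
    (hf.remainder.add hg.remainder).congr_left fun a => by simp only [Pi.add_apply]; ring⟩

lemma const_mul {f : α → ℝ} {f₀ : ℝ} {f₁ f₂ : α → ℝ} (c : ℝ) (hf : HasJet S δ f f₀ f₁ f₂) :
    HasJet S δ (fun a => c * f a) (c * f₀) (fun a => c * f₁ a) (fun a => c * f₂ a) :=
  ⟨hf.first.const_mul_left c, hf.second.const_mul_left c,
    (hf.remainder.const_mul_left c).congr_left fun a => by ring⟩

lemma sum {ι : Type*} (s : Finset ι) {f : ι → α → ℝ} {f₀ : ι → ℝ} {f₁ f₂ : ι → α → ℝ}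
    (hf : ∀ i, HasJet S δ (f i) (f₀ i) (f₁ i) (f₂ i)) :
    HasJet S δ (fun a => ∑ i ∈ s, f i a) (∑ i ∈ s, f₀ i) (fun a => ∑ i ∈ s, f₁ i a)
      (fun a => ∑ i ∈ s, f₂ i a) := by
  refine ⟨(Asymptotics.IsBigO.sum fun i (_ : i ∈ s) => (hf i).first).congr_left fun a => ?_,
    (Asymptotics.IsBigO.sum fun i (_ : i ∈ s) => (hf i).second).congr_left fun a => ?_,
    (Asymptotics.IsBigO.sum fun i (_ : i ∈ s) => (hf i).remainder).congr_left fun a => ?_⟩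
  · simp only [Finset.sum_apply]
  · simp only [Finset.sum_apply]
  · simp only [Finset.sum_apply, Finset.sum_sub_distrib, Finset.sum_add_distrib]

lemma isBigO_one {f : α → ℝ} {f₀ : ℝ} {f₁ f₂ : α → ℝ} (hδ : ∀ a ∈ S, 0 ≤ δ a ∧ δ a ≤ 1)
    (hf : HasJet S δ f f₀ f₁ f₂) : f =O[Filter.principal S] fun a => δ a ^ 0 := by
  have h1 : f₁ =O[Filter.principal S] fun a => δ a ^ 0 :=
    (by simpa using hf.first : f₁ =O[_] fun a => δ a ^ 1).trans (pow_isBigO_pow hδ (Nat.zero_le 1))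
  have h2 := hf.second.trans (pow_isBigO_pow hδ (Nat.zero_le 2))
  have h3 := hf.remainder.trans (pow_isBigO_pow hδ (Nat.zero_le 3))
  have h0 : (fun _ : α => f₀) =O[Filter.principal S] fun a => δ a ^ 0 := by
    simpa using Asymptotics.isBigO_const_const f₀ (one_ne_zero (α := ℝ)) (Filter.principal S)
  exact (h3.add ((h0.add h1).add h2)).congr_left fun a => by ring

lemma mul {f g : α → ℝ} {f₀ g₀ : ℝ} {f₁ f₂ g₁ g₂ : α → ℝ}
    (hδ : ∀ a ∈ S, 0 ≤ δ a ∧ δ a ≤ 1) (hf : HasJet S δ f f₀ f₁ f₂)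
    (hg : HasJet S δ g g₀ g₁ g₂) :
    HasJet S δ (fun a => f a * g a) (f₀ * g₀) (fun a => f₀ * g₁ a + g₀ * f₁ a)
      (fun a => f₀ * g₂ a + g₀ * f₂ a + f₁ a * g₁ a) := by
  have hf1 : f₁ =O[Filter.principal S] fun a => δ a ^ 1 := by simpa using hf.first
  have hg1 : g₁ =O[Filter.principal S] fun a => δ a ^ 1 := by simpa using hg.first
  refine ⟨(hg.first.const_mul_left _).add (hf.first.const_mul_left _),
    ((hg.second.const_mul_left _).add (hf.second.const_mul_left _)).add
      (mul_isBigO hδ le_rfl hf1 hg1), ?_⟩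
  have e1 := mul_isBigO hδ (n := 3) (by norm_num) hf.remainder (hg.isBigO_one hδ)
  have e2 := hg.remainder.const_mul_left f₀
  have e3 := mul_isBigO hδ (n := 3) (by norm_num) hf1 hg.remainder
  have e4 := mul_isBigO hδ (n := 3) (by norm_num) hf.second hg.remainder
  have e5 := mul_isBigO hδ (n := 3) (by norm_num) hf1 hg.second
  have e6 := mul_isBigO hδ (n := 3) (by norm_num) hf.second hg1
  have e7 := mul_isBigO hδ (n := 3) (by norm_num) hf.second hg.second
  exact (e1.add (e2.add (e3.add (e4.add (e5.add (e6.add e7)))))).congr_left fun a => by ring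

lemma exp {f f₁ f₂ : α → ℝ} (hδ : ∀ a ∈ S, 0 ≤ δ a ∧ δ a ≤ 1) (hf : HasJet S δ f 0 f₁ f₂) :
    HasJet S δ (fun a => Real.exp (f a)) 1 f₁ (fun a => f₂ a + f₁ a * f₁ a / 2) := by
  have h := (hf.mul hδ hf)
  have hf1 : f₁ =O[Filter.principal S] fun a => δ a ^ 1 := by simpa using hf.first
  have hfO : f =O[Filter.principal S] δ := by
    have h2 := hf.second.trans (pow_isBigO_pow hδ (show 1 ≤ 2 by norm_num))
    have h3 := hf.remainder.trans (pow_isBigO_pow hδ (show 1 ≤ 3 by norm_num))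
    exact ((h3.add (hf1.add h2)).congr (fun a => by ring) fun a => pow_one _)
  obtain ⟨K, hK, hfK⟩ := hfO.exists_pos
  rw [Asymptotics.isBigOWith_principal] at hfK
  have e1 : (fun a => Real.exp (f a) - (1 + f a + f a * f a / 2)) =O[Filter.principal S]
      fun a => δ a ^ 3 := by
    refine Asymptotics.IsBigO.of_bound (K ^ 3 * Real.exp K)
      (Filter.eventually_principal.2 fun a ha => ?_)
    have hb := Complex.norm_exp_sub_sum_le_norm_mul_exp (f a : ℂ) 3
    have e : Complex.exp (f a : ℂ) - ∑ m ∈ Finset.range 3, (f a : ℂ) ^ m / (m.factorial : ℂ) =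
        ((Real.exp (f a) - (1 + f a + f a * f a / 2) : ℝ) : ℂ) := by
      simp [Finset.sum_range_succ, Nat.factorial]
      ring
    rw [e, Complex.norm_real, Complex.norm_real] at hb
    have h1 := hfK a ha
    have h2 := hδ a ha
    rw [Real.norm_of_nonneg h2.1] at h1
    rw [Real.norm_of_nonneg (pow_nonneg h2.1 3)]
    calc _ ≤ ‖f a‖ ^ 3 * Real.exp ‖f a‖ := hb
      _ ≤ (K * δ a) ^ 3 * Real.exp K := by
        have h3 := h1.trans (mul_le_of_le_one_right hK.le h2.2)
        have h4 := norm_nonneg (f a)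
        have h5 := h4.trans h1
        gcongr
      _ = _ := by ring
  refine ⟨hf.first, hf.second.add ?_, ?_⟩
  · exact ((mul_isBigO hδ (n := 2) le_rfl hf1 hf1).const_mul_left 2⁻¹).congr_left
      fun a => by ring
  · exact (e1.add (hf.remainder.add (h.remainder.const_mul_left 2⁻¹))).congr_left fun a => by ring

lemma congr_exp {f f₁ f₂ : α → ℝ} {f₀ : ℝ} (hδ : ∀ a ∈ S, 0 ≤ δ a ∧ δ a ≤ 1)
    (hf : HasJet S δ f f₀ f₁ f₂) (h0 : f₀ = 0 := by simp) :
    HasJet S δ (fun a => Real.exp (f a)) 1 f₁ (fun a => f₂ a + f₁ a * f₁ a / 2) :=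
  exp hδ (h0 ▸ hf)

lemma isBigO_of_eq_zero {f : α → ℝ} {f₀ : ℝ} {f₁ f₂ : α → ℝ} (hf : HasJet S δ f f₀ f₁ f₂)
    (h : ∀ a ∈ S, f₀ + f₁ a + f₂ a = 0) : f =O[Filter.principal S] fun a => δ a ^ 3 := by
  refine hf.remainder.congr' (Filter.eventually_principal.2 fun a ha => ?_) Filter.EventuallyEq.rfl
  simp only [h a ha, sub_zero]

end HasJet

/-- Both sides of the single-spin exchange identity and the one-step growth of the partition
function have proportional second-order expansions around a critical profile `m`. -/
lemma exists_second_order_bound (b : ℝ) {m : Fin 3 → ℝ} (hm : ∑ c, m c = 1) :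
    ∃ C : ℝ, 0 ≤ C ∧ ∀ (δ η : ℝ) (x : Fin 3 → ℝ), 0 ≤ δ → δ ≤ 1 → (∀ c, |x c| ≤ δ) →
      ∑ c, x c = 0 → 0 ≤ η → η ≤ δ ^ 2 →
      |Real.exp (b * η) * ((∑ d, (m d + x d) * Real.exp (-b * x d)) *
          ∑ c, m c * Real.exp (b * x c)) -
        (Real.exp (b * η) - 1) * (∑ d, (m d + x d) * m d) + 1 -
        2 * (Real.exp (-(b / 2) * ∑ c, (2 * m c * x c + x c * x c)) *
          ∑ c, m c * Real.exp (b * x c) *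
            Real.exp (b / 2 * (η / (1 + η) * (1 + ∑ d, (m d + x d) * (m d + x d) -
              2 * (m c + x c)))))| ≤ C * δ ^ 3 := by
  let S : Set (ℝ × ℝ × (Fin 3 → ℝ)) := {a | 0 ≤ a.1 ∧ a.1 ≤ 1 ∧ (∀ c, |a.2.2 c| ≤ a.1) ∧
    ∑ c, a.2.2 c = 0 ∧ 0 ≤ a.2.1 ∧ a.2.1 ≤ a.1 ^ 2}
  let δ : ℝ × ℝ × (Fin 3 → ℝ) → ℝ := fun a => a.1
  have hδ : ∀ a ∈ S, 0 ≤ δ a ∧ δ a ≤ 1 := fun a ha => ⟨ha.1, ha.2.1⟩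
  have hx (c : Fin 3) : HasJet S δ (fun a => a.2.2 c) 0 (fun a => a.2.2 c) 0 := by
    refine .of_first (Asymptotics.IsBigO.of_bound 1 (Filter.eventually_principal.2 fun a ha => ?_))
    rw [one_mul, Real.norm_of_nonneg ha.1]
    exact ha.2.2.1 c
  have hη : HasJet S δ (fun a => a.2.1) 0 0 (fun a => a.2.1) := by
    refine .of_second (Asymptotics.IsBigO.of_bound 1 (Filter.eventually_principal.2 fun a ha => ?_))
    rw [one_mul, Real.norm_of_nonneg (pow_nonneg ha.1 2), Real.norm_of_nonneg ha.2.2.2.2.1]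
    exact ha.2.2.2.2.2
  have hη' : HasJet S δ (fun a => a.2.1 / (1 + a.2.1)) 0 0 (fun a => a.2.1) := by
    refine ⟨hη.first, hη.second, Asymptotics.IsBigO.of_bound 1
      (Filter.eventually_principal.2 fun a ha => ?_)⟩
    have h1 : 0 ≤ a.2.1 := ha.2.2.2.2.1
    have h2 : a.2.1 ≤ a.1 ^ 2 := ha.2.2.2.2.2
    have h3 : 0 ≤ a.1 := ha.1
    have h4 : a.1 ≤ 1 := ha.2.1
    have e : a.2.1 / (1 + a.2.1) - (0 + (0 : ℝ × ℝ × (Fin 3 → ℝ) → ℝ) a + a.2.1) =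
        -(a.2.1 ^ 2 / (1 + a.2.1)) := by
      simp only [Pi.zero_apply]; field_simp; ring
    rw [e, norm_neg, one_mul, Real.norm_of_nonneg (by positivity),
      Real.norm_of_nonneg (pow_nonneg ha.1 3)]
    calc a.2.1 ^ 2 / (1 + a.2.1) ≤ a.2.1 ^ 2 := div_le_self (by positivity) (by linarith)
      _ ≤ (a.1 ^ 2) ^ 2 := by gcongr
      _ = a.1 ^ 3 * a.1 := by ring
      _ ≤ a.1 ^ 3 := mul_le_of_le_one_right (by positivity) h4
  have hs (c : Fin 3) := (HasJet.const (S := S) (δ := δ) (m c)).add (hx c)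
  have hE := (hη.const_mul b).congr_exp hδ
  have hU := ((HasJet.sum Finset.univ fun d => (hs d).mul hδ (((hx d).const_mul (-b)).congr_exp hδ)).mul
    hδ (HasJet.sum Finset.univ fun c => (((hx c).const_mul b).congr_exp hδ).const_mul (m c)))
  have hV := ((hE.add (.const (-1))).mul hδ
    (HasJet.sum Finset.univ fun d => (hs d).mul hδ (.const (m d))))
  have hA := ((HasJet.sum Finset.univ fun c =>
    ((hx c).const_mul (2 * m c)).add ((hx c).mul hδ (hx c))).const_mul (-(b / 2))).congr_exp hδ
  have hB (c : Fin 3) := (((hη'.mul hδ (((HasJet.const (S := S) (δ := δ) 1).add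
    (HasJet.sum Finset.univ fun d => (hs d).mul hδ (hs d))).add
      ((hs c).const_mul (-2)))).const_mul (b / 2))).congr_exp hδ
  have hR := hA.mul hδ (HasJet.sum Finset.univ fun c =>
    ((((hx c).const_mul b).congr_exp hδ).const_mul (m c)).mul hδ (hB c))
  have hT := (((hE.mul hδ hU).add (hV.const_mul (-1))).add (.const 1)).add (hR.const_mul (-2))
  -- The constants give `1 + 1 - 2`, the first-order parts cancel in each factor because `∑ x = 0`,
  -- and the second-order part of the exchange side is twice that of the step side. After
  -- eliminating the third colour this is a polynomial identity.
  have hO := hT.isBigO_of_eq_zero fun a ha => by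
    have h0 : a.2.2 2 = -a.2.2 0 - a.2.2 1 := by
      have := ha.2.2.2.1
      rw [Fin.sum_univ_three] at this
      linarith
    have hm' : m 2 = 1 - m 0 - m 1 := by
      rw [Fin.sum_univ_three] at hm
      linarith
    simp only [Fin.sum_univ_three, Pi.zero_apply, Pi.add_apply, h0, hm']
    ring
  obtain ⟨C, hC, hb⟩ := hO.exists_nonneg
  refine ⟨C, hC, fun δ' η x h1 h2 h3 h4 h5 h6 => ?_⟩
  rw [Asymptotics.isBigOWith_principal] at hb
  have := hb (δ', η, x) ⟨h1, h2, h3, h4, h5, h6⟩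
  rw [Real.norm_of_nonneg (pow_nonneg (show 0 ≤ δ (δ', η, x) from h1) 3), Real.norm_eq_abs] at this
  refine (le_of_eq ?_).trans this
  congr 1
  simp only [sub_eq_add_neg, neg_mul]
  ring

/-! ### Colour counts, weights and basins under one-spin changes -/

variable {k : ℕ}

lemma sum_apply_spin (σ : Config k) (φ : Fin 3 → ℝ) :
    ∑ l, φ (σ l) = ∑ d, (colourCount σ d : ℝ) * φ d := by
  rw [← Finset.sum_fiberwise Finset.univ σ]
  refine Finset.sum_congr rfl fun d _ => ?_
  rw [Finset.sum_congr rfl (g := fun _ => φ d) fun l hl => by rw [(Finset.mem_filter.1 hl).2]]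
  simp [colourCount]

lemma sum_colourCount (σ : Config k) : ∑ d, (colourCount σ d : ℝ) = k := by
  simpa using (sum_apply_spin σ fun _ => 1).symm

lemma colourCount_le (σ : Config k) (c : Fin 3) : colourCount σ c ≤ k := by
  simpa [colourCount] using Finset.card_filter_le Finset.univ fun l : Fin k => σ l = c

lemma colourRatio_nonneg (σ : Config k) (c : Fin 3) : 0 ≤ colourRatio σ c := by
  unfold colourRatio; positivity

lemma colourRatio_le_one (σ : Config k) (c : Fin 3) : colourRatio σ c ≤ 1 :=
  div_le_one_of_le₀ (by exact_mod_cast colourCount_le σ c) (Nat.cast_nonneg k)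

lemma sum_colourRatio (hk : 0 < k) (σ : Config k) : ∑ c, colourRatio σ c = 1 := by
  simp only [colourRatio]
  rw [← Finset.sum_div, sum_colourCount, div_self (by positivity)]

lemma mul_colourRatio (hk : 0 < k) (σ : Config k) (c : Fin 3) :
    (k : ℝ) * colourRatio σ c = colourCount σ c := by
  have : (k : ℝ) ≠ 0 := by positivity
  rw [colourRatio]; field_simp

lemma weight_pos (σ : Config k) : 0 < weight criticalBeta σ := Real.exp_pos _

lemma weight_eq (hk : 0 < k) (σ : Config k) : weight criticalBeta σ =
    Real.exp (2 * Real.log 2 * (∑ c, (colourCount σ c : ℝ) ^ 2) / k) := by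
  have : (k : ℝ) ≠ 0 := by positivity
  simp only [weight, criticalBeta, colourRatio, div_pow]
  rw [← Finset.sum_div]
  congr 1
  field_simp

lemma prod_exp_spin (hk : 0 < k) (σ : Config k) (φ : Fin 3 → ℝ) :
    ∏ l, Real.exp (φ (σ l)) = Real.exp (k * ∑ c, colourRatio σ c * φ c) := by
  rw [← Real.exp_sum, sum_apply_spin, Finset.mul_sum]
  simp_rw [← mul_assoc, mul_colourRatio hk]

/-- Moving one spin. -/
lemma colourCount_update (σ : Config k) (l : Fin k) (c i : Fin 3) :
    (colourCount (Function.update σ l c) i : ℝ) =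
      colourCount σ i + (if c = i then 1 else 0) - (if σ l = i then 1 else 0) := by
  have h (τ : Config k) : (colourCount τ i : ℝ) =
      (if τ l = i then 1 else 0) + ∑ j ∈ Finset.univ.erase l, if τ j = i then (1 : ℝ) else 0 := by
    rw [Finset.add_sum_erase _ (fun j => if τ j = i then (1 : ℝ) else 0) (Finset.mem_univ l)]
    simp [colourCount]
  rw [h, h σ, Finset.sum_congr rfl (g := fun j => if σ j = i then (1 : ℝ) else 0) fun j hj => by
    rw [Function.update_of_ne (Finset.ne_of_mem_erase hj)], Function.update_self]
  ring

lemma abs_colourRatio_update_sub_le (σ : Config k) (l : Fin k) (c i : Fin 3) :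
    |colourRatio (Function.update σ l c) i - colourRatio σ i| ≤ (k : ℝ)⁻¹ := by
  rw [colourRatio, colourRatio, colourCount_update, ← sub_div, div_eq_mul_inv, abs_mul,
    abs_of_nonneg (inv_nonneg.2 (Nat.cast_nonneg (α := ℝ) k))]
  refine mul_le_of_le_one_left (by positivity) ?_
  split_ifs <;> simp

lemma weight_update (hk : 0 < k) (σ : Config k) (l : Fin k) (c : Fin 3) :
    weight criticalBeta (Function.update σ l c) = weight criticalBeta σ *
      Real.exp (4 * Real.log 2 * (colourRatio σ c - colourRatio σ (σ l)) +
        4 * Real.log 2 * (k : ℝ)⁻¹ * if c = σ l then 0 else 1) := by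
  have : (k : ℝ) ≠ 0 := by positivity
  rw [weight_eq hk, weight_eq hk, ← Real.exp_add]
  congr 1
  simp only [colourCount_update, colourRatio]
  field_simp
  generalize σ l = d
  rw [Fin.sum_univ_three, Fin.sum_univ_three]
  fin_cases c <;> fin_cases d <;> simp <;> ring

lemma colourCount_snoc (σ : Config k) (c i : Fin 3) :
    (colourCount (Fin.snoc (α := fun _ => Fin 3) σ c : Config (k + 1)) i : ℝ) =
      colourCount σ i + if c = i then 1 else 0 := by
  have h {n : ℕ} (τ : Config n) : (colourCount τ i : ℝ) = ∑ j, if τ j = i then (1 : ℝ) else 0 := by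
    simp [colourCount]
  rw [h, h, Fin.sum_univ_castSucc]
  simp

lemma weight_snoc (hk : 0 < k) (σ : Config k) (c : Fin 3) :
    weight criticalBeta (Fin.snoc (α := fun _ => Fin 3) σ c : Config (k + 1)) =
      weight criticalBeta σ * Real.exp (4 * Real.log 2 * colourRatio σ c -
        2 * Real.log 2 * (∑ i, colourRatio σ i ^ 2) + 2 * Real.log 2 * (((k : ℝ) + 1)⁻¹ *
          (1 + ∑ i, colourRatio σ i ^ 2 - 2 * colourRatio σ c))) := by
  have : (k : ℝ) ≠ 0 := by positivity
  rw [weight_eq hk, weight_eq k.succ_pos, ← Real.exp_add]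
  congr 1
  simp only [colourCount_snoc, colourRatio]
  push_cast
  field_simp
  simp only [Fin.sum_univ_three]
  fin_cases c <;> simp <;> field_simp <;> ring

/-- Exchanging the spin `l` with an extra spin. -/
lemma sum_exchange (l : Fin k) (g : Config k → Fin 3 → ℝ) :
    ∑ σ, ∑ c, g σ c = ∑ σ, ∑ c, g (Function.update σ l c) (σ l) := by
  let e : Config k × Fin 3 → Config k × Fin 3 := fun p => (Function.update p.1 l p.2, p.1 l)
  have he : Function.Involutive e := fun p => by simp [e]
  rw [← Fintype.sum_prod_type', ← Fintype.sum_prod_type']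
  exact (Equiv.sum_comp he.toPerm fun p : Config k × Fin 3 => g p.1 p.2).symm

lemma exists_inBasin (s : Fin 3 → ℝ) : ∃ r, InBasin r s := by
  by_cases h : ∀ i, s i ≤ 1 / 2
  · exact ⟨3, by simpa [InBasin] using h⟩
  · push Not at h
    obtain ⟨i, hi⟩ := h
    exact ⟨i.castSucc, by simpa [InBasin] using hi⟩

lemma InBasin.unique {s : Fin 3 → ℝ} (h0 : ∀ i, 0 ≤ s i) (h1 : ∑ i, s i = 1) {r r' : Fin 4}
    (hr : InBasin r s) (hr' : InBasin r' s) : r = r' := by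
  rw [Fin.sum_univ_three] at h1
  have n0 := h0 0
  have n1 := h0 1
  have n2 := h0 2
  fin_cases r <;> fin_cases r' <;> simp [InBasin, Fin.forall_fin_succ] at hr hr' ⊢ <;> linarith

/-- `1/6` is the gap between the threshold `1/2` and the deciding coordinate `2/3` or `1/3` of a
centre. -/
lemma InBasin.of_near {s s' : Fin 3 → ℝ} {δ η : ℝ} (h : δ + η < 1 / 6) {r : Fin 4}
    (hs : ∀ c, |s c - center r c| ≤ δ) (hs' : ∀ c, |s' c - s c| ≤ η) : InBasin r s' := by
  have key (c : Fin 3) : center r c - 1 / 6 < s' c ∧ s' c < center r c + 1 / 6 := by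
    have h1 := abs_le.1 (hs c)
    have h2 := abs_le.1 (hs' c)
    exact ⟨by linarith [h1.1, h2.1], by linarith [h1.2, h2.2]⟩
  unfold InBasin
  split_ifs with hr
  · have := (key ⟨r, hr⟩).1
    rw [center, if_neg hr.ne, if_pos rfl] at this
    linarith
  · intro i
    have := (key i).2
    rw [center, if_pos (by omega)] at this
    linarith

/-! ### Concentration near the centres and lower bounds for basin weights -/

/-- The total weight of a fixed vector of colour counts. -/
lemma sum_weight_fiber_le (hk : 0 < k) (σ : Config k) (A : Finset (Config k))
    (hA : ∀ τ ∈ A, ∀ c, colourCount τ c = colourCount σ c) :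
    ∑ τ ∈ A, weight criticalBeta τ ≤
      ((∑ c, Real.exp (4 * Real.log 2 * colourRatio σ c)) *
        Real.exp (-(2 * Real.log 2 * ∑ c, colourRatio σ c ^ 2))) ^ k := by
  -- For fixed colour counts the quadratic energy equals its linearisation at its own profile, so
  -- the weight is a product over spins; summing this product over all configurations factorises.
  have h (τ) (hτ : τ ∈ A) : weight criticalBeta τ =
      (∏ l, Real.exp (4 * Real.log 2 * colourRatio σ (τ l))) *
        Real.exp (-(2 * Real.log 2 * ∑ c, colourRatio σ c ^ 2)) ^ k := by
    rw [prod_exp_spin hk τ fun c => 4 * Real.log 2 * colourRatio σ c, ← Real.exp_nat_mul,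
      ← Real.exp_add, weight, criticalBeta]
    have : ∀ c, colourRatio τ c = colourRatio σ c := fun c => by
      simp only [colourRatio, hA τ hτ c]
    simp only [this, Finset.mul_sum, ← Finset.sum_neg_distrib, ← Finset.sum_add_distrib]
    congr 1
    refine Finset.sum_congr rfl fun c _ => ?_
    ring
  rw [Finset.sum_congr rfl h, ← Finset.sum_mul, mul_pow, Fintype.sum_pow]
  refine mul_le_mul_of_nonneg_right ?_ (by positivity)
  exact Finset.sum_le_sum_of_subset_of_nonneg (Finset.subset_univ A)
    fun _ _ _ => Finset.prod_nonneg fun _ _ => (Real.exp_pos _).le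

/-- `σ` is at distance more than `δ` from the centre of its basin. -/
def IsFar (δ : ℝ) (σ : Config k) : Prop :=
  ∃ r c, InBasin r (colourRatio σ) ∧ δ < |colourRatio σ c - center r c|

-- Method of types: there are at most `(k + 1) ^ 3` vectors of counts, and `sum_exp_le` bounds the
-- weight of each.
open Classical in
lemma sum_weight_far_le (hk : 0 < k) {δ : ℝ} (hδ : 0 ≤ δ) :
    ∑ σ : Config k with IsFar δ σ, weight criticalBeta σ ≤
      ((k : ℝ) + 1) ^ 3 * (growthRate ^ k * Real.exp (-(k * δ ^ 2 / 4000))) := by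
  let f : Config k → Fin 3 → Fin (k + 1) := fun σ c => ⟨colourCount σ c, by
    have := colourCount_le σ c; omega⟩
  rw [← Finset.sum_fiberwise _ f]
  have key : ∀ a : Fin 3 → Fin (k + 1), ∑ σ ∈ Finset.univ.filter (IsFar (k := k) δ) with f σ = a,
      weight criticalBeta σ ≤ growthRate ^ k * Real.exp (-(k * δ ^ 2 / 4000)) := by
    intro a
    rcases Finset.eq_empty_or_nonempty ((Finset.univ.filter (IsFar (k := k) δ)).filter
      fun σ => f σ = a) with h | ⟨σ, hσ⟩
    · rw [h, Finset.sum_empty]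
      have := growthRate_pos
      positivity
    · have hσ' := Finset.mem_filter.1 hσ
      obtain ⟨r, c, hr, hc⟩ := (Finset.mem_filter.1 hσ'.1).2
      refine (sum_weight_fiber_le hk σ _ fun τ hτ c => ?_).trans ?_
      · have := congrFun ((Finset.mem_filter.1 hτ).2.trans hσ'.2.symm) c
        simpa [f] using this
      · have hg := growthRate_pos
        have h1 := sum_exp_le (colourRatio_nonneg σ) (sum_colourRatio hk σ) hr c
        calc _ ≤ (growthRate * Real.exp (2 * Real.log 2 * ∑ i, colourRatio σ i ^ 2) *
              Real.exp (-(1 / 4000 * (colourRatio σ c - center r c) ^ 2)) *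
              Real.exp (-(2 * Real.log 2 * ∑ c, colourRatio σ c ^ 2))) ^ k := by gcongr
          _ = growthRate ^ k *
              Real.exp (-(k * (colourRatio σ c - center r c) ^ 2 / 4000)) := by
            rw [mul_assoc, mul_assoc, ← Real.exp_add, ← Real.exp_add, mul_pow, ← Real.exp_nat_mul]
            congr 2
            ring
          _ ≤ _ := by
            rw [← sq_abs (colourRatio σ c - center r c)]
            gcongr
  refine (Finset.sum_le_card_nsmul _ _ _ fun a _ => key a).trans (le_of_eq ?_)
  simp

/-- By the fixed-point equation the product is the exponential of the tangent at `center r` to the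
convex energy `∑ s ^ 2`. -/
lemma growthRate_pow_mul_prod_le (hk : 0 < k) (σ : Config k) (r : Fin 4) :
    growthRate ^ k * ∏ l, center r (σ l) ≤ weight criticalBeta σ := by
  have hg := growthRate_pos
  have h1 (c : Fin 3) : growthRate * center r c = Real.exp (4 * Real.log 2 * center r c -
      2 * Real.log 2 * ∑ i, center r i ^ 2) := by
    rw [Real.exp_sub, exp_center]
    field_simp
  have h2 : growthRate ^ k * ∏ l, center r (σ l) = ∏ l, (growthRate * center r (σ l)) := by
    rw [Finset.prod_mul_distrib]; simp
  rw [h2]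
  simp_rw [h1]
  rw [prod_exp_spin hk σ fun c => 4 * Real.log 2 * center r c -
      2 * Real.log 2 * ∑ i, center r i ^ 2, weight, criticalBeta]
  rw [Real.exp_le_exp, mul_assoc (k : ℝ) (2 * Real.log 2)]
  refine mul_le_mul_of_nonneg_left ?_ (Nat.cast_nonneg (α := ℝ) k)
  simp_rw [mul_sub]
  rw [Finset.sum_sub_distrib, ← Finset.sum_mul, sum_colourRatio hk, one_mul,
    Finset.mul_sum, Finset.mul_sum, ← Finset.sum_sub_distrib]
  refine Finset.sum_le_sum fun c _ => ?_
  have := Real.log_pos one_lt_two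
  nlinarith [mul_nonneg this.le (sq_nonneg (colourRatio σ c - center r c))]

lemma prod_exp_ite_spin (hk : 0 < k) (σ : Config k) (i : Fin 3) (v : ℝ) :
    ∏ l, Real.exp (if σ l = i then v else -v) = Real.exp (k * (v * (2 * colourRatio σ i - 1))) := by
  rw [prod_exp_spin hk σ fun c => if c = i then v else -v]
  congr 2
  have h (c : Fin 3) : colourRatio σ c * (if c = i then v else -v) =
      2 * v * (if c = i then colourRatio σ c else 0) - v * colourRatio σ c := by
    split_ifs <;> ring
  simp_rw [h]
  rw [Finset.sum_sub_distrib, ← Finset.mul_sum, ← Finset.mul_sum, sum_colourRatio hk]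
  simp
  ring

/-- The exponential tilt used to bound the probability of leaving the basin `r`. -/
def tilt (r : Fin 4) (i c : Fin 3) : ℝ :=
  if (r : ℕ) = 3 then if c = i then 4 / 3 else 3 / 4
  else if (c : ℕ) = (r : ℕ) then 3 / 4 else 4 / 3

lemma tilt_pos (r : Fin 4) (i c : Fin 3) : 0 < tilt r i c := by
  unfold tilt; split_ifs <;> norm_num

/-- In every case the sum is `1/2 + 4/9`; being below 1, it makes the Chernoff bound decay
exponentially. -/
lemma sum_center_mul_tilt (r : Fin 4) (i : Fin 3) : ∑ c, center r c * tilt r i c = 17 / 18 := by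
  fin_cases r <;> fin_cases i <;> simp [center, tilt, Fin.sum_univ_three] <;> norm_num

lemma exists_one_le_prod_tilt (hk : 0 < k) (σ : Config k) {r : Fin 4}
    (h : ¬ InBasin r (colourRatio σ)) : ∃ i, 1 ≤ ∏ l, tilt r i (σ l) := by
  have hv : 0 < Real.log (4 / 3) := Real.log_pos (by norm_num)
  have e1 : Real.exp (Real.log (4 / 3)) = 4 / 3 := Real.exp_log (by norm_num)
  have e2 : Real.exp (-Real.log (4 / 3)) = 3 / 4 := by rw [Real.exp_neg, e1]; norm_num
  by_cases hr : (r : ℕ) < 3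
  · rw [InBasin, dif_pos hr, not_lt] at h
    have h1 := prod_exp_ite_spin hk σ ⟨r, hr⟩ (-Real.log (4 / 3))
    refine ⟨0, ?_⟩
    calc (1 : ℝ) ≤ Real.exp (k * (-Real.log (4 / 3) * (2 * colourRatio σ ⟨r, hr⟩ - 1))) :=
          Real.one_le_exp (mul_nonneg (Nat.cast_nonneg k) (by nlinarith))
      _ = _ := by
        rw [← h1]
        refine Finset.prod_congr rfl fun l _ => ?_
        simp only [tilt, hr.ne, if_false, Fin.ext_iff]
        split_ifs
        · exact e2
        · rw [neg_neg, e1]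
  · rw [InBasin, dif_neg hr] at h
    push Not at h
    obtain ⟨i, hi⟩ := h
    have h1 := prod_exp_ite_spin hk σ i (Real.log (4 / 3))
    refine ⟨i, ?_⟩
    calc (1 : ℝ) ≤ Real.exp (k * (Real.log (4 / 3) * (2 * colourRatio σ i - 1))) :=
          Real.one_le_exp (mul_nonneg (Nat.cast_nonneg k) (by nlinarith))
      _ = _ := by
        rw [← h1]
        refine Finset.prod_congr rfl fun l _ => ?_
        have : (r : ℕ) = 3 := by omega
        simp only [tilt, this, if_true]
        split_ifs
        · exact e1
        · exact e2

open Classical in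
/-- The total weight of the basin `r`. -/
def basinMass (k : ℕ) (r : Fin 4) : ℝ :=
  ∑ σ : Config k with InBasin r (colourRatio σ), weight criticalBeta σ

-- Chernoff bound for independent spins of law `center r`, with a union over three tilts; `100 ≤ k`
-- ensures `3 * (17/18) ^ k ≤ 1/2`.
open Classical in
lemma half_le_sum_prod_center (hk : 100 ≤ k) (r : Fin 4) :
    1 / 2 ≤ ∑ σ : Config k with InBasin r (colourRatio σ), ∏ l, center r (σ l) := by
  have hk0 : 0 < k := by omega
  have h1 : ∑ σ : Config k, ∏ l, center r (σ l) = 1 := by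
    rw [← Fintype.sum_pow, sum_center, one_pow]
  have hnn (σ : Config k) : 0 ≤ ∏ l, center r (σ l) :=
    Finset.prod_nonneg fun l _ => (center_pos r _).le
  have h2 : ∑ σ : Config k with ¬ InBasin r (colourRatio σ), ∏ l, center r (σ l) ≤
      3 * (17 / 18) ^ k := by
    calc _ ≤ ∑ σ : Config k with ¬ InBasin r (colourRatio σ),
          ∑ i, (∏ l, center r (σ l)) * ∏ l, tilt r i (σ l) := by
          refine Finset.sum_le_sum fun σ hσ => ?_
          obtain ⟨i, hi⟩ := exists_one_le_prod_tilt hk0 σ (Finset.mem_filter.1 hσ).2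
          refine (le_mul_of_one_le_right (hnn σ) hi).trans
            (Finset.single_le_sum (f := fun i => (∏ l, center r (σ l)) * ∏ l, tilt r i (σ l))
              (fun j _ => ?_) (Finset.mem_univ i))
          exact mul_nonneg (hnn σ) (Finset.prod_nonneg fun l _ => (tilt_pos r j _).le)
      _ ≤ ∑ σ : Config k, ∑ i, (∏ l, center r (σ l)) * ∏ l, tilt r i (σ l) := by
          refine Finset.sum_le_sum_of_subset_of_nonneg (Finset.subset_univ _) fun σ _ _ => ?_
          exact Finset.sum_nonneg fun i _ => mul_nonneg (hnn σ)
            (Finset.prod_nonneg fun l _ => (tilt_pos r i _).le)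
      _ = 3 * (17 / 18) ^ k := by
          have h (i : Fin 3) : ∑ σ : Config k, (∏ l, center r (σ l)) * ∏ l, tilt r i (σ l) =
              (17 / 18) ^ k := by
            simp_rw [← Finset.prod_mul_distrib]
            rw [← Fintype.sum_pow fun c => center r c * tilt r i c, sum_center_mul_tilt]
          rw [Finset.sum_comm]
          simp [h]
  have h3 : (17 / 18 : ℝ) ^ k ≤ 1 / 6 := by
    have h4 : (6 : ℝ) ≤ (18 / 17) ^ k := by
      have := one_add_mul_le_pow (a := (1 / 17 : ℝ)) (by norm_num) k
      have hk' : (100 : ℝ) ≤ k := by exact_mod_cast hk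
      norm_num at this ⊢
      linarith
    rw [show (17 / 18 : ℝ) = (18 / 17)⁻¹ by norm_num, inv_pow, one_div]
    gcongr
  have := Finset.sum_filter_add_sum_filter_not Finset.univ
    (fun σ : Config k => InBasin r (colourRatio σ)) fun σ => ∏ l, center r (σ l)
  linarith

lemma growthRate_pow_le (hk : 100 ≤ k) (r : Fin 4) : growthRate ^ k ≤ 2 * basinMass k r := by
  classical
  have h1 := half_le_sum_prod_center hk r
  have hg := pow_pos growthRate_pos k
  have h2 : growthRate ^ k * ∑ σ : Config k with InBasin r (colourRatio σ), ∏ l, center r (σ l) ≤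
      basinMass k r := by
    rw [Finset.mul_sum, basinMass]
    exact Finset.sum_le_sum fun σ _ => growthRate_pow_mul_prod_le (by omega) σ r
  nlinarith

/-! ### The step factor and the exchange identity -/

/-- The factor by which the weight of `σ` grows when one spin is added. -/
def stepFactor (σ : Config k) : ℝ :=
  ∑ c, Real.exp (4 * Real.log 2 * colourRatio σ c -
    2 * Real.log 2 * (∑ i, colourRatio σ i ^ 2) + 2 * Real.log 2 * (((k : ℝ) + 1)⁻¹ *
      (1 + ∑ i, colourRatio σ i ^ 2 - 2 * colourRatio σ c)))

/-- The contribution to the exchange identity from the extra spin `c` replacing a spin `d`. -/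
def exchangeTerm (r : Fin 4) (σ : Config k) (d c : Fin 3) : ℝ :=
  Real.exp (4 * Real.log 2 * (colourRatio σ c - colourRatio σ d) +
    4 * Real.log 2 * (k : ℝ)⁻¹ * if c = d then 0 else 1) *
    Real.exp (4 * Real.log 2 * center r d)

/-- The factor of the exchange identity, averaged over the replaced spin. -/
def exchangeFactor (r : Fin 4) (σ : Config k) : ℝ :=
  ∑ d, colourRatio σ d * ∑ c, exchangeTerm r σ d c

lemma exchangeTerm_pos (r : Fin 4) (σ : Config k) (d c : Fin 3) : 0 < exchangeTerm r σ d c :=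
  mul_pos (Real.exp_pos _) (Real.exp_pos _)

lemma center_le_one (r : Fin 4) (c : Fin 3) : center r c ≤ 1 := by
  unfold center; split_ifs <;> norm_num

lemma exchangeTerm_le (r : Fin 4) (σ : Config k) (d c : Fin 3) :
    exchangeTerm r σ d c ≤ Real.exp (12 * Real.log 2) := by
  have hL := Real.log_pos one_lt_two
  have h1 := colourRatio_le_one σ c
  have h2 := colourRatio_nonneg σ d
  have h3 : (k : ℝ)⁻¹ ≤ 1 := Nat.cast_inv_le_one k
  have h4 := center_le_one r d
  have h5 : (k : ℝ)⁻¹ * (if c = d then 0 else 1) ≤ 1 := by split_ifs <;> simp [h3]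
  rw [exchangeTerm, ← Real.exp_add, Real.exp_le_exp, mul_assoc (4 * Real.log 2) (k : ℝ)⁻¹]
  nlinarith

lemma exchangeFactor_nonneg (r : Fin 4) (σ : Config k) : 0 ≤ exchangeFactor r σ :=
  Finset.sum_nonneg fun d _ => mul_nonneg (colourRatio_nonneg σ d)
    (Finset.sum_nonneg fun c _ => (exchangeTerm_pos r σ d c).le)

lemma exchangeFactor_le (hk : 0 < k) (r : Fin 4) (σ : Config k) :
    exchangeFactor r σ ≤ 3 * Real.exp (12 * Real.log 2) := by
  calc exchangeFactor r σ ≤ ∑ d, colourRatio σ d * (3 * Real.exp (12 * Real.log 2)) := by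
        refine Finset.sum_le_sum fun d _ => mul_le_mul_of_nonneg_left ?_ (colourRatio_nonneg σ d)
        refine (Finset.sum_le_sum fun c _ => exchangeTerm_le r σ d c).trans (le_of_eq ?_)
        simp
    _ = _ := by rw [← Finset.sum_mul, sum_colourRatio hk, one_mul]

lemma sum_weight_snoc (hk : 0 < k) (σ : Config k) :
    ∑ c, weight criticalBeta (Fin.snoc (α := fun _ => Fin 3) σ c : Config (k + 1)) =
      weight criticalBeta σ * stepFactor σ := by
  simp_rw [weight_snoc hk, stepFactor, Finset.mul_sum]

lemma sum_sq_colourRatio_le (hk : 0 < k) (σ : Config k) : ∑ i, colourRatio σ i ^ 2 ≤ 1 := by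
  rw [← sum_colourRatio hk σ]
  refine Finset.sum_le_sum fun i _ => ?_
  nlinarith [colourRatio_nonneg σ i, colourRatio_le_one σ i]

lemma stepFactor_exponent_bounds (hk : 0 < k) (σ : Config k) (c : Fin 3) :
    -(2 * Real.log 2) ≤ 4 * Real.log 2 * colourRatio σ c -
      2 * Real.log 2 * (∑ i, colourRatio σ i ^ 2) + 2 * Real.log 2 * (((k : ℝ) + 1)⁻¹ *
        (1 + ∑ i, colourRatio σ i ^ 2 - 2 * colourRatio σ c)) ∧
    4 * Real.log 2 * colourRatio σ c -
      2 * Real.log 2 * (∑ i, colourRatio σ i ^ 2) + 2 * Real.log 2 * (((k : ℝ) + 1)⁻¹ *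
        (1 + ∑ i, colourRatio σ i ^ 2 - 2 * colourRatio σ c)) ≤ 8 * Real.log 2 := by
  have hL := Real.log_pos one_lt_two
  have h1 := colourRatio_le_one σ c
  have h2 := colourRatio_nonneg σ c
  have h3 := sum_sq_colourRatio_le hk σ
  have h4 : 0 ≤ ∑ i, colourRatio σ i ^ 2 := Finset.sum_nonneg fun i _ => sq_nonneg _
  have h5 : 0 ≤ ((k : ℝ) + 1)⁻¹ := by positivity
  have h6 : ((k : ℝ) + 1)⁻¹ ≤ 1 := inv_le_one_of_one_le₀ (by
    have : (0 : ℝ) ≤ k := Nat.cast_nonneg k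
    linarith)
  set q := ∑ i, colourRatio σ i ^ 2
  set s := colourRatio σ c
  set e := ((k : ℝ) + 1)⁻¹
  have h7 : 4 * Real.log 2 * s - 2 * Real.log 2 * q + 2 * Real.log 2 * (e * (1 + q - 2 * s)) =
      2 * Real.log 2 * (e + (1 - e) * (2 * s - q)) := by ring
  rw [h7]
  constructor
  · nlinarith [mul_nonneg (sub_nonneg.2 h6) h2, mul_nonneg (sub_nonneg.2 h6) h4,
      mul_nonneg (sub_nonneg.2 h6) (sub_nonneg.2 h3)]
  · have : e + (1 - e) * (2 * s - q) ≤ 4 := by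
      nlinarith [mul_nonneg (sub_nonneg.2 h6) (sub_nonneg.2 h1), mul_nonneg (sub_nonneg.2 h6) h4]
    nlinarith

lemma le_stepFactor (hk : 0 < k) (σ : Config k) :
    3 * Real.exp (-(2 * Real.log 2)) ≤ stepFactor σ := by
  refine le_trans (le_of_eq ?_) (Finset.sum_le_sum fun c _ =>
    Real.exp_le_exp.2 (stepFactor_exponent_bounds hk σ c).1)
  simp

lemma stepFactor_le (hk : 0 < k) (σ : Config k) :
    stepFactor σ ≤ 3 * Real.exp (8 * Real.log 2) := by
  refine (Finset.sum_le_sum fun c _ =>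
    Real.exp_le_exp.2 (stepFactor_exponent_bounds hk σ c).2).trans (le_of_eq ?_)
  simp

/-- The total weight of one extra spin at the critical profile `center r`. -/
def fieldMass (r : Fin 4) : ℝ :=
  growthRate * Real.exp (2 * Real.log 2 * ∑ i, center r i ^ 2)

lemma fieldMass_pos (r : Fin 4) : 0 < fieldMass r := mul_pos growthRate_pos (Real.exp_pos _)

lemma sum_exp_center (r : Fin 4) :
    ∑ c, Real.exp (4 * Real.log 2 * center r c) = fieldMass r := by
  simp_rw [exp_center]
  rw [← Finset.mul_sum, sum_center, mul_one, fieldMass]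

-- Attach to `σ` an extra spin `c` of weight `exp (4 * log 2 * center r c)`, swap it with spin `l`
-- and sum over `l`. The identity is exact, with the basin indicator evaluated after the swap.
open Classical in
lemma exchange_identity (hk : 0 < k) (r : Fin 4) :
    (k : ℝ) * (fieldMass r * basinMass k r) = ∑ σ : Config k, weight criticalBeta σ *
      ∑ l, ∑ c, exchangeTerm r σ (σ l) c *
        if InBasin r (colourRatio (Function.update σ l c)) then 1 else 0 := by
  have h1 : fieldMass r * basinMass k r = ∑ σ : Config k, ∑ c : Fin 3,
      (if InBasin r (colourRatio σ) then 1 else 0) * weight criticalBeta σ *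
        Real.exp (4 * Real.log 2 * center r c) := by
    simp_rw [← Finset.mul_sum, sum_exp_center]
    rw [← Finset.sum_mul, mul_comm, basinMass, Finset.sum_filter]
    simp only [ite_mul, one_mul, zero_mul]
  have h2 (l : Fin k) : fieldMass r * basinMass k r = ∑ σ : Config k, weight criticalBeta σ *
      ∑ c, exchangeTerm r σ (σ l) c *
        if InBasin r (colourRatio (Function.update σ l c)) then 1 else 0 := by
    rw [h1, sum_exchange l]
    refine Finset.sum_congr rfl fun σ _ => ?_
    rw [Finset.mul_sum]
    refine Finset.sum_congr rfl fun c _ => ?_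
    rw [weight_update hk, exchangeTerm]
    ring
  calc _ = ∑ _l : Fin k, fieldMass r * basinMass k r := by simp
    _ = ∑ l : Fin k, ∑ σ : Config k, weight criticalBeta σ * ∑ c, exchangeTerm r σ (σ l) c *
        if InBasin r (colourRatio (Function.update σ l c)) then 1 else 0 :=
      Finset.sum_congr rfl fun l _ => h2 l
    _ = _ := by rw [Finset.sum_comm]; simp_rw [← Finset.mul_sum]

lemma mul_exchangeFactor (hk : 0 < k) (r : Fin 4) (σ : Config k) :
    k * exchangeFactor r σ = ∑ l, ∑ c, exchangeTerm r σ (σ l) c := by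
  rw [sum_apply_spin σ fun d => ∑ c, exchangeTerm r σ d c, exchangeFactor, Finset.mul_sum]
  simp_rw [← mul_assoc, mul_colourRatio hk]

/-- Away from the basin boundary, moving one spin does not change the basin. -/
lemma inBasin_update_iff (hk : 0 < k) {δ : ℝ} (hδ : δ + (k : ℝ)⁻¹ < 1 / 6) {σ : Config k}
    (h : ¬ IsFar δ σ) (l : Fin k) (c : Fin 3) (r : Fin 4) :
    InBasin r (colourRatio (Function.update σ l c)) ↔ InBasin r (colourRatio σ) := by
  obtain ⟨r', hr'⟩ := exists_inBasin (colourRatio σ)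
  have h1 : InBasin r' (colourRatio (Function.update σ l c)) :=
    InBasin.of_near hδ (fun c => not_lt.1 fun hc => h ⟨r', c, hr', hc⟩)
      (abs_colourRatio_update_sub_le σ l c)
  constructor
  · intro hr
    rwa [hr.unique (colourRatio_nonneg _) (sum_colourRatio hk _) h1]
  · intro hr
    rwa [hr.unique (colourRatio_nonneg _) (sum_colourRatio hk _) hr']

-- Moving the indicator back to `σ` costs only the far configurations, since one move changes
-- proportions by at most `1/k`.
open Classical in
lemma abs_exchange_sub_le (hk : 0 < k) {δ : ℝ} (hδ : δ + (k : ℝ)⁻¹ < 1 / 6) (r : Fin 4) :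
    |fieldMass r * basinMass k r - ∑ σ : Config k with InBasin r (colourRatio σ),
      weight criticalBeta σ * exchangeFactor r σ| ≤
    3 * Real.exp (12 * Real.log 2) * ∑ σ : Config k with IsFar δ σ, weight criticalBeta σ := by
  have hk' : (0 : ℝ) < k := by exact_mod_cast hk
  have h1 : (k : ℝ) * (fieldMass r * basinMass k r - ∑ σ : Config k with InBasin r (colourRatio σ),
      weight criticalBeta σ * exchangeFactor r σ) =
      ∑ σ : Config k, weight criticalBeta σ * ∑ l, ∑ c, exchangeTerm r σ (σ l) c *
        ((if InBasin r (colourRatio (Function.update σ l c)) then 1 else 0) -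
          if InBasin r (colourRatio σ) then 1 else 0) := by
    rw [mul_sub, exchange_identity hk, Finset.sum_filter, Finset.mul_sum, ← Finset.sum_sub_distrib]
    refine Finset.sum_congr rfl fun σ _ => ?_
    simp_rw [mul_sub, Finset.sum_sub_distrib, ← Finset.sum_mul, ← mul_exchangeFactor hk]
    split_ifs <;> ring
  have h2 : |(k : ℝ) * (fieldMass r * basinMass k r -
      ∑ σ : Config k with InBasin r (colourRatio σ), weight criticalBeta σ * exchangeFactor r σ)| ≤
      k * (3 * Real.exp (12 * Real.log 2) *
        ∑ σ : Config k with IsFar δ σ, weight criticalBeta σ) := by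
    rw [h1, Finset.sum_filter, Finset.mul_sum, Finset.mul_sum]
    refine (Finset.abs_sum_le_sum_abs _ _).trans (Finset.sum_le_sum fun σ _ => ?_)
    by_cases hfar : IsFar δ σ
    · rw [if_pos hfar, abs_mul, abs_of_pos (weight_pos σ)]
      calc _ ≤ weight criticalBeta σ * ∑ l, ∑ c, exchangeTerm r σ (σ l) c := by
            refine mul_le_mul_of_nonneg_left ?_ (weight_pos σ).le
            refine (Finset.abs_sum_le_sum_abs _ _).trans (Finset.sum_le_sum fun l _ => ?_)
            refine (Finset.abs_sum_le_sum_abs _ _).trans (Finset.sum_le_sum fun c _ => ?_)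
            rw [abs_mul, abs_of_pos (exchangeTerm_pos r σ _ _)]
            refine mul_le_of_le_one_right (exchangeTerm_pos r σ _ _).le ?_
            split_ifs <;> simp
        _ = k * (weight criticalBeta σ * exchangeFactor r σ) := by
            rw [← mul_exchangeFactor hk]; ring
        _ ≤ k * (weight criticalBeta σ * (3 * Real.exp (12 * Real.log 2))) := by
            have := weight_pos σ
            have := exchangeFactor_le hk r σ
            gcongr
        _ = _ := by ring
    · rw [if_neg hfar]
      simp_rw [inBasin_update_iff hk hδ hfar]
      simp
  rw [abs_mul, abs_of_pos hk'] at h2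
  exact le_of_mul_le_mul_left h2 hk'

/-! ### Matching the exchange factor with the step factor -/

lemma stepFactor_eq (hk : 0 < k) (σ : Config k) (r : Fin 4) {x : Fin 3 → ℝ}
    (hx : ∀ c, center r c + x c = colourRatio σ c) :
    stepFactor σ = growthRate *
      (Real.exp (-(4 * Real.log 2 / 2) * ∑ c, (2 * center r c * x c + x c * x c)) *
        ∑ c, center r c * Real.exp (4 * Real.log 2 * x c) *
          Real.exp (4 * Real.log 2 / 2 * ((k : ℝ)⁻¹ / (1 + (k : ℝ)⁻¹) *
            (1 + ∑ d, (center r d + x d) * (center r d + x d) - 2 * (center r c + x c))))) := by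
  have hk' : (0 : ℝ) < k := by exact_mod_cast hk
  have hη : (k : ℝ)⁻¹ / (1 + (k : ℝ)⁻¹) = ((k : ℝ) + 1)⁻¹ := by field_simp
  have h1 : ∑ c, (2 * center r c * x c + x c * x c) =
      ∑ c, colourRatio σ c ^ 2 - ∑ c, center r c ^ 2 := by
    rw [← Finset.sum_sub_distrib]
    refine Finset.sum_congr rfl fun c _ => ?_
    rw [← hx]; ring
  have h2 : ∑ d, (center r d + x d) * (center r d + x d) = ∑ c, colourRatio σ c ^ 2 :=
    Finset.sum_congr rfl fun c _ => by rw [hx c, sq]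
  have h3 (c : Fin 3) : growthRate * center r c = Real.exp (4 * Real.log 2 * center r c -
      2 * Real.log 2 * ∑ i, center r i ^ 2) := by
    rw [Real.exp_sub, exp_center]
    field_simp
  rw [h1, h2, hη, stepFactor]
  generalize ∑ c, colourRatio σ c ^ 2 = q
  generalize ∑ c, center r c ^ 2 = p at h3
  rw [Finset.mul_sum, Finset.mul_sum]
  refine Finset.sum_congr rfl fun c _ => ?_
  have h4 (A B D : ℝ) : growthRate * (A * (center r c * B * D)) =
      growthRate * center r c * (A * (B * D)) := by ring
  rw [hx, h4, h3, ← Real.exp_add, ← Real.exp_add, ← Real.exp_add, ← hx]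
  congr 1
  ring

lemma exchangeFactor_eq (r : Fin 4) (σ : Config k) {x : Fin 3 → ℝ}
    (hx : ∀ c, center r c + x c = colourRatio σ c) :
    exchangeFactor r σ = fieldMass r *
      (Real.exp (4 * Real.log 2 * (k : ℝ)⁻¹) *
        ((∑ d, (center r d + x d) * Real.exp (-(4 * Real.log 2) * x d)) *
          ∑ c, center r c * Real.exp (4 * Real.log 2 * x c)) -
      (Real.exp (4 * Real.log 2 * (k : ℝ)⁻¹) - 1) * ∑ d, (center r d + x d) * center r d) := by
  have h1 (d c : Fin 3) : exchangeTerm r σ d c = fieldMass r *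
      (Real.exp (-(4 * Real.log 2) * x d) * (center r c * Real.exp (4 * Real.log 2 * x c))) *
        (Real.exp (4 * Real.log 2 * (k : ℝ)⁻¹) -
          if c = d then Real.exp (4 * Real.log 2 * (k : ℝ)⁻¹) - 1 else 0) := by
    have h2 : fieldMass r *
        (Real.exp (-(4 * Real.log 2) * x d) * (center r c * Real.exp (4 * Real.log 2 * x c))) =
        Real.exp (4 * Real.log 2 * (colourRatio σ c - colourRatio σ d)) *
          Real.exp (4 * Real.log 2 * center r d) := by
      have : Real.exp (4 * Real.log 2 * center r c) = fieldMass r * center r c := exp_center r c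
      rw [mul_left_comm, ← mul_assoc (fieldMass r), ← this, ← Real.exp_add, ← Real.exp_add,
        ← Real.exp_add, ← hx, ← hx]
      congr 1
      ring
    rw [h2, exchangeTerm, Real.exp_add]
    split_ifs
    · simp
    · simp
      ring
  have h3 (d : Fin 3) : ∑ c, exchangeTerm r σ d c = fieldMass r *
      (Real.exp (4 * Real.log 2 * (k : ℝ)⁻¹) * (Real.exp (-(4 * Real.log 2) * x d) *
        ∑ c, center r c * Real.exp (4 * Real.log 2 * x c)) -
        (Real.exp (4 * Real.log 2 * (k : ℝ)⁻¹) - 1) * center r d) := by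
    have h4 : Real.exp (-(4 * Real.log 2) * x d) * Real.exp (4 * Real.log 2 * x d) = 1 := by
      rw [← Real.exp_add]; simp
    simp_rw [h1, mul_sub, Finset.sum_sub_distrib]
    simp only [mul_ite, mul_zero, Finset.sum_ite_eq', Finset.mem_univ, if_true,
      ← Finset.sum_mul, ← Finset.mul_sum]
    linear_combination (-fieldMass r * center r d *
      (Real.exp (4 * Real.log 2 * (k : ℝ)⁻¹) - 1)) * h4
  rw [exchangeFactor]
  simp_rw [h3, ← hx, Fin.sum_univ_three]
  ring

lemma exists_abs_exchange_sub_step_le : ∃ C : ℝ, 0 ≤ C ∧ ∀ (k : ℕ) (δ : ℝ) (r : Fin 4)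
    (σ : Config k), 0 < k → 0 ≤ δ → δ ≤ 1 → (k : ℝ)⁻¹ ≤ δ ^ 2 → InBasin r (colourRatio σ) →
    ¬ IsFar δ σ → |exchangeFactor r σ / fieldMass r + 1 - 2 * (stepFactor σ / growthRate)| ≤
      C * δ ^ 3 := by
  choose C hC hb using fun r => exists_second_order_bound (4 * Real.log 2) (sum_center r)
  refine ⟨∑ r, C r, Finset.sum_nonneg fun r _ => hC r, fun k δ r σ hk h0 h1 hkδ hr hfar => ?_⟩
  have hx (c : Fin 3) : center r c + (colourRatio σ c - center r c) = colourRatio σ c := by ring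
  have := hb r δ (k : ℝ)⁻¹ (fun c => colourRatio σ c - center r c) h0 h1
    (fun c => not_lt.1 fun hc => hfar ⟨r, c, hr, hc⟩)
    (by rw [Finset.sum_sub_distrib, sum_colourRatio hk, sum_center, sub_self]) (by positivity) hkδ
  rw [exchangeFactor_eq r σ hx, stepFactor_eq hk σ r hx, mul_div_cancel_left₀ _ (fieldMass_pos r).ne',
    mul_div_cancel_left₀ _ growthRate_pos.ne']
  exact this.trans (mul_le_mul_of_nonneg_right
    (Finset.single_le_sum (fun r _ => hC r) (Finset.mem_univ r)) (by positivity))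

open Classical in
/-- The total weight of the configurations of `k + 1` spins whose first `k` spins lie in the
basin `r`. -/
def steppedMass (k : ℕ) (r : Fin 4) : ℝ :=
  ∑ σ : Config k with InBasin r (colourRatio σ), weight criticalBeta σ * stepFactor σ

lemma basinMass_nonneg (r : Fin 4) : 0 ≤ basinMass k r :=
  Finset.sum_nonneg fun σ _ => (weight_pos σ).le

/-- Within each basin, adding a spin multiplies the total weight by nearly `growthRate`. -/
lemma exists_abs_steppedMass_sub_le : ∃ C : ℝ, 0 ≤ C ∧ ∀ (k : ℕ) (δ : ℝ) (r : Fin 4),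
    100 ≤ k → 0 ≤ δ → δ ≤ 1 / 24 → (k : ℝ)⁻¹ ≤ δ ^ 2 →
    ((k : ℝ) + 1) ^ 3 * Real.exp (-(k * δ ^ 2 / 4000)) ≤ 8 * δ ^ 3 →
    |steppedMass k r / growthRate - basinMass k r| ≤ C * δ ^ 3 * basinMass k r := by
  classical
  obtain ⟨C, hC, hb⟩ := exists_abs_exchange_sub_step_le
  set E := Real.exp (12 * Real.log 2)
  set K := ∑ r, 3 * E / fieldMass r
  have hgr := growthRate_pos
  have hKr (r : Fin 4) : 3 * E / fieldMass r ≤ K :=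
    Finset.single_le_sum (f := fun r => 3 * E / fieldMass r)
      (fun r _ => div_nonneg (by positivity) (fieldMass_pos r).le) (Finset.mem_univ r)
  have hK : 0 ≤ K := Finset.sum_nonneg fun r _ =>
    div_nonneg (by positivity) (fieldMass_pos r).le
  set K' := K + 1 + 2 * (3 * Real.exp (8 * Real.log 2) / growthRate)
  have hK' : 0 ≤ K' := by positivity
  refine ⟨C + 16 * (K' + K), by positivity, fun k δ r hk h0 h1 hkδ hfar => ?_⟩
  have hk0 : 0 < k := by omega
  have hfm := fieldMass_pos r
  set W := basinMass k r with hW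
  set V := steppedMass k r with hV
  set T := ∑ σ : Config k with InBasin r (colourRatio σ),
      weight criticalBeta σ * exchangeFactor r σ with hT
  set N := ∑ σ : Config k with IsFar δ σ, weight criticalBeta σ with hN
  have hN0 : 0 ≤ N := Finset.sum_nonneg fun σ _ => (weight_pos σ).le
  have hNW : N ≤ 16 * δ ^ 3 * W := by
    have hW2 := growthRate_pow_le hk r
    calc N ≤ ((k : ℝ) + 1) ^ 3 * (growthRate ^ k * Real.exp (-(k * δ ^ 2 / 4000))) :=
          sum_weight_far_le hk0 h0
      _ = (((k : ℝ) + 1) ^ 3 * Real.exp (-(k * δ ^ 2 / 4000))) * growthRate ^ k := by ring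
      _ ≤ 8 * δ ^ 3 * (2 * W) := by gcongr
      _ = _ := by ring
  have e1 : |W - T / fieldMass r| ≤ K * N := by
    have h2 := abs_exchange_sub_le hk0 (δ := δ) (by nlinarith) r
    calc |W - T / fieldMass r| = |fieldMass r * W - T| / fieldMass r := by
          rw [← abs_of_pos hfm, ← abs_div, abs_of_pos hfm]
          congr 1
          field_simp
      _ ≤ 3 * E * N / fieldMass r := by gcongr
      _ = 3 * E / fieldMass r * N := by ring
      _ ≤ K * N := by gcongr; exact hKr r
  have e2 : |T / fieldMass r + W - 2 * (V / growthRate)| ≤ C * δ ^ 3 * W + K' * N := by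
    have h2 : T / fieldMass r + W - 2 * (V / growthRate) =
        ∑ σ : Config k with InBasin r (colourRatio σ), weight criticalBeta σ *
          (exchangeFactor r σ / fieldMass r + 1 - 2 * (stepFactor σ / growthRate)) := by
      rw [hT, hW, hV, basinMass, steppedMass, Finset.sum_div, Finset.sum_div, Finset.mul_sum,
        ← Finset.sum_add_distrib, ← Finset.sum_sub_distrib]
      exact Finset.sum_congr rfl fun σ _ => by ring
    rw [h2]
    refine (Finset.abs_sum_le_sum_abs _ _).trans ?_
    have h3 : ∑ σ : Config k with InBasin r (colourRatio σ),
        (if IsFar δ σ then weight criticalBeta σ else 0) ≤ N := by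
      rw [← Finset.sum_filter, hN]
      refine Finset.sum_le_sum_of_subset_of_nonneg (fun σ hσ => ?_) fun σ _ _ => (weight_pos σ).le
      exact Finset.mem_filter.2 ⟨Finset.mem_univ σ, (Finset.mem_filter.1 hσ).2⟩
    have h4 : C * δ ^ 3 * W = ∑ σ : Config k with InBasin r (colourRatio σ),
        C * δ ^ 3 * weight criticalBeta σ := by rw [hW, basinMass, Finset.mul_sum]
    refine le_trans ?_ (add_le_add_right (mul_le_mul_of_nonneg_left h3 hK') _)
    rw [h4, Finset.mul_sum, ← Finset.sum_add_distrib]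
    refine Finset.sum_le_sum fun σ hσ => ?_
    have hw := weight_pos σ
    rw [abs_mul, abs_of_pos hw]
    by_cases hf : IsFar δ σ
    · rw [if_pos hf]
      have h5 : |exchangeFactor r σ / fieldMass r + 1 - 2 * (stepFactor σ / growthRate)| ≤ K' := by
        have a1 : 0 ≤ exchangeFactor r σ / fieldMass r :=
          div_nonneg (exchangeFactor_nonneg r σ) hfm.le
        have a2 : exchangeFactor r σ / fieldMass r ≤ K :=
          (div_le_div_of_nonneg_right (exchangeFactor_le hk0 r σ) hfm.le).trans (hKr r)
        have a3 : 0 ≤ stepFactor σ / growthRate :=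
          div_nonneg ((by positivity : (0 : ℝ) ≤ _).trans (le_stepFactor hk0 σ)) hgr.le
        have a4 : stepFactor σ / growthRate ≤ 3 * Real.exp (8 * Real.log 2) / growthRate :=
          div_le_div_of_nonneg_right (stepFactor_le hk0 σ) hgr.le
        rw [abs_le]
        constructor <;> simp only [K'] <;> linarith
      have := mul_le_mul_of_nonneg_left h5 hw.le
      have : 0 ≤ C * δ ^ 3 * weight criticalBeta σ := by positivity
      linarith
    · rw [if_neg hf, mul_zero, add_zero, mul_comm]
      exact mul_le_mul_of_nonneg_right
        (hb k δ r σ hk0 h0 (by linarith) hkδ (Finset.mem_filter.1 hσ).2 hf) hw.le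
  have hW0 : 0 ≤ W := basinMass_nonneg r
  -- The exchange average `T` is eliminated: `T / fieldMass r` is close to `W` by `e1`, and its sum
  -- with `W` is close to `2 * V / growthRate` by `e2`.
  have e3 : |2 * (V / growthRate - W)| ≤ C * δ ^ 3 * W + (K' + K) * N := by
    have : 2 * (V / growthRate - W) =
        -(T / fieldMass r + W - 2 * (V / growthRate)) + -(W - T / fieldMass r) := by ring
    rw [this]
    refine (abs_add_le _ _).trans ?_
    rw [abs_neg, abs_neg]
    linarith
  rw [abs_mul, abs_two] at e3
  have e4 := mul_le_mul_of_nonneg_left hNW (add_nonneg hK' hK)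
  have e5 : 0 ≤ C * δ ^ 3 * W := mul_nonneg (mul_nonneg hC (pow_nonneg h0 3)) hW0
  have e6 : 0 ≤ (K' + K) * (16 * δ ^ 3 * W) := hN0.trans hNW |> mul_nonneg (add_nonneg hK' hK)
  have e7 : (C + 16 * (K' + K)) * δ ^ 3 * W =
      C * δ ^ 3 * W + (K' + K) * (16 * δ ^ 3 * W) := by ring
  rw [e7]
  linarith

/-! ### From weights to the growth of basin probabilities -/

lemma partitionFunction_pos (k : ℕ) : 0 < partitionFunction criticalBeta k :=
  Finset.sum_pos (fun σ _ => weight_pos σ) Finset.univ_nonempty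

lemma partitionFunction_succ (hk : 0 < k) : partitionFunction criticalBeta (k + 1) =
    ∑ σ : Config k, weight criticalBeta σ * stepFactor σ := by
  rw [partitionFunction, ← (Fin.snocEquiv fun _ : Fin (k + 1) => Fin 3).sum_comp,
    Fintype.sum_prod_type, Finset.sum_comm]
  exact Finset.sum_congr rfl fun σ _ => sum_weight_snoc hk σ

open Classical in
lemma sum_sum_inBasin (hk : 0 < k) (f : Config k → ℝ) :
    ∑ r, ∑ σ : Config k with InBasin r (colourRatio σ), f σ = ∑ σ, f σ := by
  simp_rw [Finset.sum_filter]
  rw [Finset.sum_comm]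
  refine Finset.sum_congr rfl fun σ _ => ?_
  obtain ⟨r, hr⟩ := exists_inBasin (colourRatio σ)
  rw [Finset.sum_eq_single_of_mem r (Finset.mem_univ r), if_pos hr]
  intro r' _ hne
  exact if_neg fun h => hne (h.unique (colourRatio_nonneg σ) (sum_colourRatio hk σ) hr)

lemma sum_basinMass (hk : 0 < k) : ∑ r, basinMass k r = partitionFunction criticalBeta k :=
  sum_sum_inBasin hk _

lemma sum_steppedMass (hk : 0 < k) :
    ∑ r, steppedMass k r = partitionFunction criticalBeta (k + 1) := by
  rw [partitionFunction_succ hk]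
  exact sum_sum_inBasin hk _

lemma steppedMass_le (hk : 0 < k) (r : Fin 4) :
    steppedMass k r ≤ 3 * Real.exp (8 * Real.log 2) * basinMass k r := by
  rw [steppedMass, basinMass, Finset.mul_sum]
  refine Finset.sum_le_sum fun σ _ => ?_
  rw [mul_comm]
  exact mul_le_mul_of_nonneg_right (stepFactor_le hk σ) (weight_pos σ).le

lemma mul_partitionFunction_le (hk : 0 < k) :
    3 * Real.exp (-(2 * Real.log 2)) * partitionFunction criticalBeta k ≤
      partitionFunction criticalBeta (k + 1) := by
  rw [partitionFunction_succ hk, partitionFunction, Finset.mul_sum]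
  refine Finset.sum_le_sum fun σ _ => ?_
  rw [mul_comm]
  exact mul_le_mul_of_nonneg_left (le_stepFactor hk σ) (weight_pos σ).le

/-- The growth of the probability of the basin `r` when one spin is added. -/
def basinGrowth (k : ℕ) (r : Fin 4) : ℝ :=
  steppedMass k r / partitionFunction criticalBeta (k + 1) /
    (basinMass k r / partitionFunction criticalBeta k)

lemma basinGrowth_le {r : Fin 4} {a b : ℝ} (ha : 0 ≤ a) (hb : 0 < b)
    (h1 : steppedMass k r ≤ a * basinMass k r)
    (h2 : b * partitionFunction criticalBeta k ≤ partitionFunction criticalBeta (k + 1)) :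
    basinGrowth k r ≤ a / b := by
  have hZ := partitionFunction_pos k
  have hZ' := partitionFunction_pos (k + 1)
  have hW := basinMass_nonneg (k := k) r
  rw [basinGrowth]
  refine div_le_of_le_mul₀ (by positivity) (by positivity) ?_
  rw [div_le_iff₀ hZ']
  calc steppedMass k r ≤ a * basinMass k r := h1
    _ = a / b * (basinMass k r / partitionFunction criticalBeta k) *
        (b * partitionFunction criticalBeta k) := by field_simp
    _ ≤ _ := by gcongr

lemma basinGrowth_le_const (hk : 0 < k) (r : Fin 4) : basinGrowth k r ≤
    3 * Real.exp (8 * Real.log 2) / (3 * Real.exp (-(2 * Real.log 2))) :=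
  basinGrowth_le (by positivity) (by positivity) (steppedMass_le hk r) (mul_partitionFunction_le hk)

lemma exists_basinGrowth_le_of_delta : ∃ C : ℝ, 0 ≤ C ∧ ∀ (k : ℕ) (δ : ℝ) (r : Fin 4),
    0 < k → 0 ≤ δ → (k : ℝ)⁻¹ ≤ δ ^ 2 →
    ((k : ℝ) + 1) ^ 3 * Real.exp (-(k * δ ^ 2 / 4000)) ≤ 8 * ((k : ℝ)⁻¹) ^ 2 →
    basinGrowth k r ≤ 1 + C * δ ^ 3 := by
  obtain ⟨C, hC, hb⟩ := exists_abs_steppedMass_sub_le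
  set B := 3 * Real.exp (8 * Real.log 2) / (3 * Real.exp (-(2 * Real.log 2))) with hB
  have hB0 : 0 ≤ B := by positivity
  -- The summands serve the main case, the case `C * δ ^ 3 > 1/2` and the case `δ > 1/24`; in the
  -- last two the crude bound `B` suffices.
  refine ⟨4 * C + 2 * B * C + 24 ^ 3 * B, by positivity, fun k δ r hk h0 hkδ hfar => ?_⟩
  have hconst := basinGrowth_le_const hk r
  rw [← hB] at hconst
  have hδ3 : 0 ≤ δ ^ 3 := by positivity
  rw [add_mul, add_mul]
  have p1 : 0 ≤ 4 * C * δ ^ 3 := by positivity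
  have p2 : 0 ≤ 2 * B * C * δ ^ 3 := by positivity
  have p3 : 0 ≤ 24 ^ 3 * B * δ ^ 3 := by positivity
  rcases lt_or_ge (1 / 24) δ with hδ | hδ
  · have h1 : (1 / 24 : ℝ) ^ 3 ≤ δ ^ 3 := by gcongr
    have h2 : B * (24 ^ 3 * (1 / 24) ^ 3) ≤ B * (24 ^ 3 * δ ^ 3) := by gcongr
    linarith
  rcases lt_or_ge (1 / 2) (C * δ ^ 3) with hε | hε
  · have h2 : B * (1 / 2) ≤ B * (C * δ ^ 3) := by gcongr
    linarith
  have hk' : (0 : ℝ) < k := by exact_mod_cast hk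
  have hk100 : 100 ≤ k := by
    have h1 : (k : ℝ)⁻¹ ≤ (1 / 24) ^ 2 := hkδ.trans (by gcongr)
    rw [inv_le_comm₀ hk' (by norm_num)] at h1
    norm_num at h1
    omega
  have hfar' : ((k : ℝ) + 1) ^ 3 * Real.exp (-(k * δ ^ 2 / 4000)) ≤ 8 * δ ^ 3 := by
    refine hfar.trans ?_
    have h1 : ((k : ℝ)⁻¹) ^ 2 ≤ (δ ^ 2) ^ 2 := by gcongr
    have h2 : (δ ^ 2) ^ 2 ≤ δ ^ 3 := by
      rw [← pow_mul]; exact pow_le_pow_of_le_one h0 (by linarith) (by norm_num)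
    linarith
  set ε := C * δ ^ 3 with hεdef
  have hε0 : 0 ≤ ε := by positivity
  have hg := growthRate_pos
  have key (r : Fin 4) := abs_le.1 (hb k δ r hk100 h0 hδ hkδ hfar')
  have h1 : steppedMass k r ≤ growthRate * (1 + ε) * basinMass k r := by
    have := (key r).2
    rw [sub_le_iff_le_add, div_le_iff₀ hg] at this
    linarith
  -- The lower bounds can be added up because all basins share the same rate.
  have h2 : growthRate * (1 - ε) * partitionFunction criticalBeta k ≤
      partitionFunction criticalBeta (k + 1) := by
    rw [← sum_basinMass hk, ← sum_steppedMass hk, Finset.mul_sum]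
    refine Finset.sum_le_sum fun r _ => ?_
    have := (key r).1
    rw [le_sub_iff_add_le, le_div_iff₀ hg] at this
    linarith
  have h3 := basinGrowth_le (by positivity) (mul_pos hg (by linarith)) h1 h2
  rw [mul_div_mul_left _ _ hg.ne'] at h3
  have h4 : (1 + ε) / (1 - ε) ≤ 1 + 4 * ε := by
    rw [div_le_iff₀ (by linarith)]
    nlinarith
  linarith

lemma exists_basinGrowth_le : ∃ C : ℝ, 0 ≤ C ∧ ∀ (k : ℕ) (r : Fin 4), 2 ≤ k →
    basinGrowth k r ≤ 1 + C * (Real.log k ^ (3 / 2 : ℝ) / (k : ℝ) ^ (3 / 2 : ℝ)) := by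
  obtain ⟨C, hC, hb⟩ := exists_basinGrowth_le_of_delta
  refine ⟨C * 150 ^ 3, by positivity, fun k r hk => ?_⟩
  have hk2 : (2 : ℝ) ≤ k := by exact_mod_cast hk
  have hk' : (0 : ℝ) < k := by linarith
  have hlog : 1 / 2 ≤ Real.log k := by
    have h1 := Real.log_le_log two_pos hk2
    have h2 := Real.log_two_gt_d9
    norm_num at h2
    linarith
  have hlog0 : 0 ≤ Real.log k := by linarith
  set g := Real.sqrt (Real.log k / k) with hg
  have hg2 : g ^ 2 = Real.log k / k := Real.sq_sqrt (by positivity)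
  have hg3 : Real.log k ^ (3 / 2 : ℝ) / (k : ℝ) ^ (3 / 2 : ℝ) = g ^ 3 := by
    rw [← Real.div_rpow hlog0 hk'.le, Real.rpow_div_two_eq_sqrt _ (by positivity), ← hg]
    norm_cast
  -- Since `150 ^ 2 / 4000 > 5`, the Gaussian factor is at most `k ^ (-5)`, which beats `(k + 1) ^ 3
  -- ≤ 8 * k ^ 3` with `k ^ (-2)` to spare.
  have := hb k (150 * g) r (by omega) (by positivity) ?_ ?_
  · rw [hg3]
    refine this.trans (le_of_eq ?_)
    ring
  · rw [mul_pow, hg2, inv_eq_one_div, ← mul_div_assoc]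
    gcongr
    linarith
  · have h1 : Real.exp (-(k * (150 * g) ^ 2 / 4000)) ≤ ((k : ℝ)⁻¹) ^ 5 := by
      have : ((k : ℝ)⁻¹) ^ 5 = Real.exp (-(5 * Real.log k)) := by
        rw [Real.exp_neg, show 5 * Real.log (k : ℝ) = ((5 : ℕ) : ℝ) * Real.log k by norm_num,
          Real.exp_nat_mul, Real.exp_log hk', inv_pow]
      rw [this, Real.exp_le_exp, mul_pow, hg2]
      have e : (k : ℝ) * (150 ^ 2 * (Real.log k / k)) / 4000 = 22500 / 4000 * Real.log k := by
        field_simp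
        norm_num
      rw [e]
      linarith
    calc ((k : ℝ) + 1) ^ 3 * Real.exp (-(k * (150 * g) ^ 2 / 4000)) ≤
          (2 * k) ^ 3 * ((k : ℝ)⁻¹) ^ 5 := by gcongr; linarith
      _ = 8 * ((k : ℝ)⁻¹) ^ 2 := by field_simp; norm_num

/-! ### Interpolating distributions, modes and growth constants -/

lemma sum_initialSpins (k n : ℕ) (f : Config k → ℝ) :
    ∑ x : Config (k + n), f (initialSpins (Nat.le_add_right k n) x) = 3 ^ n * ∑ σ, f σ := by
  induction n with
  | zero => simp; rfl
  | succ n ih =>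
    refine ((Fin.snocEquiv fun _ : Fin (k + n + 1) => Fin 3).sum_comp fun x =>
      f (initialSpins (Nat.le_add_right k (n + 1)) x)).symm.trans ?_
    rw [Fintype.sum_prod_type, pow_succ']
    have h (c : Fin 3) (y : Config (k + n)) : initialSpins (Nat.le_add_right k (n + 1))
        (Fin.snocEquiv (fun _ : Fin (k + n + 1) => Fin 3) (c, y)) =
        initialSpins (Nat.le_add_right k n) y := by
      funext l
      exact Fin.snoc_castSucc (α := fun _ => Fin 3) c y (Fin.castLE (Nat.le_add_right k n) l)
    have h' (c : Fin 3) : ∑ y : Config (k + n), f (initialSpins (Nat.le_add_right k (n + 1))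
        (Fin.snocEquiv (fun _ : Fin (k + n + 1) => Fin 3) (c, y))) = 3 ^ n * ∑ σ, f σ := by
      rw [← ih]
      exact Finset.sum_congr rfl fun y _ => by rw [h]
    rw [Finset.sum_congr rfl fun c _ => h' c]
    simp
    ring

open Classical in
lemma interpProb_initialSpins {M : ℕ} (h : k ≤ M) (P : Config k → Prop) :
    interpProb h {x | P (initialSpins h x)} =
      (∑ σ with P σ, weight criticalBeta σ) / partitionFunction criticalBeta k := by
  obtain ⟨n, rfl⟩ := Nat.exists_eq_add_of_le h
  have h1 := sum_initialSpins k n fun σ => if P σ then potts criticalBeta σ else 0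
  rw [interpProb, Finset.sum_filter, Finset.sum_filter, Finset.sum_div]
  simp only [interpMass, Set.mem_ofPred_eq, Nat.add_sub_cancel_left]
  calc _ = (∑ x : Config (k + n), if P (initialSpins h x) then
          potts criticalBeta (initialSpins h x) else 0) * (1 / 3 : ℝ) ^ n := by
        rw [Finset.sum_mul]
        exact Finset.sum_congr rfl fun x _ => by split_ifs <;> simp
    _ = ∑ σ : Config k, if P σ then potts criticalBeta σ else 0 := by
        rw [h1, mul_right_comm, ← mul_pow]
        norm_num
    _ = _ := Finset.sum_congr rfl fun σ _ => by rw [potts, ite_div, zero_div]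

-- An event about the first `k` spins does not see spin `k + 1`; summing that spin out produces
-- `stepFactor`.
open Classical in
lemma interpProb_succ_initialSpins {M : ℕ} (hk : 0 < k) (h : k + 1 ≤ M) (P : Config k → Prop) :
    interpProb h {x | P (initialSpins (Nat.le_of_succ_le h) x)} =
      (∑ σ with P σ, weight criticalBeta σ * stepFactor σ) /
        partitionFunction criticalBeta (k + 1) := by
  have h1 := interpProb_initialSpins h fun τ : Config (k + 1) => P (initialSpins k.le_succ τ)
  refine h1.trans ?_
  congr 1
  rw [Finset.sum_filter, Finset.sum_filter,
    ← (Fin.snocEquiv fun _ : Fin (k + 1) => Fin 3).sum_comp, Fintype.sum_prod_type, Finset.sum_comm]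
  refine Finset.sum_congr rfl fun σ _ => ?_
  have h2 (c : Fin 3) : initialSpins k.le_succ
      (Fin.snocEquiv (fun _ : Fin (k + 1) => Fin 3) (c, σ)) = σ := by
    funext l
    exact Fin.snoc_castSucc (α := fun _ => Fin 3) c σ l
  simp_rw [h2]
  rw [← sum_weight_snoc hk]
  split_ifs
  · rfl
  · simp

lemma interpProb_univ {M : ℕ} (h : k ≤ M) : interpProb h (Set.univ : Set (Config M)) = 1 := by
  classical
  have := interpProb_initialSpins h fun _ => True
  simp only [Finset.filter_true] at this
  rw [← Set.ofPred_true, this]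
  exact div_self (partitionFunction_pos k).ne'

instance (J k : ℕ) : Nonempty (Fin (numModes J k)) := by
  unfold numModes; split_ifs <;> infer_instance

lemma growthConst_of_le {J M : ℕ} (hJ : k ≤ J) (h : k + 1 ≤ M) : growthConst J h = 1 := by
  simp only [growthConst, mode, if_pos hJ, interpProb_univ, div_one, ciSup_const]

lemma mode_of_lt {J M : ℕ} (hJ : J < k) (h : k ≤ M) (r : Fin (numModes J k)) (hr : (r : ℕ) < 4) :
    mode J h r = {x | InBasin ⟨r, hr⟩ (colourRatio (initialSpins h x))} := by
  rw [mode, if_neg (not_le.2 hJ)]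
  ext x
  by_cases h3 : (r : ℕ) < 3
  · simp [InBasin, h3, majoritySet]
  · simp [InBasin, h3, majoritySet]

lemma growthConst_le {J M : ℕ} (hJ : J < k) (h : k + 1 ≤ M) {B : ℝ}
    (hB : ∀ r, basinGrowth k r ≤ B) : growthConst J h ≤ B := by
  refine ciSup_le fun r => ?_
  have hr : (r : ℕ) < 4 := r.2.trans_eq (if_neg (not_le.2 hJ))
  rw [mode_of_lt hJ _ r hr, interpProb_initialSpins (Nat.le_of_succ_le h) fun σ =>
    InBasin ⟨r, hr⟩ (colourRatio σ), interpProb_succ_initialSpins (by omega) h fun σ =>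
    InBasin ⟨r, hr⟩ (colourRatio σ)]
  exact hB ⟨r, hr⟩

end MeanFieldPotts
end

theorem mainTheorem6 :
    ∃ C : ℝ, 0 < C ∧ ∀ J : ℕ, 1 ≤ J → ∀ M : ℕ,
      (∀ h : 0 + 1 ≤ M, MeanFieldPotts.growthConst J (k := 0) (M := M) h = 1) ∧
      (∀ h : 1 + 1 ≤ M, MeanFieldPotts.growthConst J (k := 1) (M := M) h = 1) ∧
      (∀ (j : ℕ) (h : j + 1 ≤ M), 2 ≤ j →
        MeanFieldPotts.growthConst J (k := j) (M := M) h ≤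
          1 + C * (Real.log (j : ℝ) ^ (3 / 2 : ℝ) / (j : ℝ) ^ (3 / 2 : ℝ))) := by
  obtain ⟨C, hC, hb⟩ := MeanFieldPotts.exists_basinGrowth_le
  refine ⟨C + 1, by linarith, fun J hJ M => ⟨fun h => MeanFieldPotts.growthConst_of_le (by omega) h,
    fun h => MeanFieldPotts.growthConst_of_le hJ h, fun j h hj => ?_⟩⟩
  have hpos : 0 ≤ Real.log (j : ℝ) ^ (3 / 2 : ℝ) / (j : ℝ) ^ (3 / 2 : ℝ) :=
    div_nonneg (Real.rpow_nonneg (Real.log_natCast_nonneg j) _)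
      (Real.rpow_nonneg (Nat.cast_nonneg j) _)
  rcases le_or_gt j J with hjJ | hjJ
  · rw [MeanFieldPotts.growthConst_of_le hjJ h]
    nlinarith
  · refine MeanFieldPotts.growthConst_le hjJ h fun r => (hb j r hj).trans ?_
    gcongr
    linarith
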